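/- **Setting.** Let $x_{t+1}=Ax_t+w_t$ ($t\ge 0$) and $y_t=Cx_t+v_t$ ($t\ge 1$), with $x_t\in\mathbb R^{n_x}$, $y_t\in\mathbb R^{n_y}$, where $w_t\sim\mathcal N(0,Q)$ and $v_t\sim\mathcal N(0,R)$ are white and mutually uncorrelated and $x_0\sim\mathcal N(\bar x_0,\bar P_0)$ with $\bar P_0$ positive definite. The covariances $Q,R$ are unknown, but $Q\in\mathcal Q$, $R\in\mathcal R$, where $\mathcal Q,\mathcal R$ are given measurable sets of symmetric positive definite matrices, of positive Lebesgue measure in the spaces of symmetric matrices. For symmetric positive definite $\Delta$ of size $d$ and $\gamma>d+1$ let $\mathcal W^{-1}(G;\Delta,\gamma)\propto |G|^{-(\gamma+d+1)/2}e^{-\frac12\operatorname{tr}(\Delta G^{-1})}$ be the inverse Wishart density. For a set $\mathcal S$ and a matrix function $f$ put $$\mathsf E_{\mathcal S}[f;\Delta,\gamma]=\frac{\int_{\mathcal S}f(G)\,\mathcal W^{-1}(G;\Delta,\gamma)\,dG}{\int_{\mathcal S}\mathcal W^{-1}(G;\Delta,\gamma)\,dG}.$$ **The VB-MHE filter.**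 Fix integers $T\ge 1$ (window length), $N\ge 1$ (variational iterations), $\rho\in(0,1)$, positive definite $\bar M_0,\bar S_0$, and $\bar m_0>n_x+1$, $\bar s_0>n_y+1$. Put $\Phi_{T-1}=\mathsf E_{\mathcal Q}[Q^{-1};\bar M_0,\bar m_0]$ and $\Psi_{T-1}=\mathsf E_{\mathcal R}[R^{-1};\bar S_0,\bar s_0]$. At each time $t\ge T$, given $\bar x_{t-T},\bar P_{t-T},\bar M_{t-T},\bar m_{t-T},\bar S_{t-T},\bar s_{t-T},\Phi_{t-1},\Psi_{t-1}$: (1) Set $\Phi_t^{(0)}=\Phi_{t-1}$, $\Psi_t^{(0)}=\Psi_{t-1}$, $m_t=\bar m_{t-T}+T$, $s_t=\bar s_{t-T}+T$. For $k=1,\dots,N$, with $\Phi=\Phi_t^{(k-1)}$, $\Psi=\Psi_t^{(k-1)}$: let $\hat x^{(k)}_{t-T:t}$ and $P^{(k)}_{t-T:t}$ be the minimizer and the inverse of the (constant) Hessian of $$x_{t-T:t}\mapsto\tfrac12\Big[\|x_{t-T}-\bar x_{t-T}\|^2_{\bar P_{t-T}^{-1}}+\sum_{i=t-T+1}^{t}\big(\|y_i-Cx_i\|_\Psi^2+\|x_i-Ax_{i-1}\|_\Phi^2\big)\Big],$$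 and, writing $\hat x_i,P_i,P_{i,j}$ for the blocks of $\hat x^{(k)}_{t-T:t}$ and $P^{(k)}_{t-T:t}$, $$M_t^{(k)}=\bar M_{t-T}+\sum_{i=t-T+1}^{t}\big[(\hat x_i-A\hat x_{i-1})(\hat x_i-A\hat x_{i-1})'+P_i+AP_{i-1}A'-P_{i,i-1}A'-AP_{i-1,i}\big],$$ $$S_t^{(k)}=\bar S_{t-T}+\sum_{i=t-T+1}^{t}\big[(y_i-C\hat x_i)(y_i-C\hat x_i)'+CP_iC'\big],$$ $$\Phi_t^{(k)}=\mathsf E_{\mathcal Q}[Q^{-1};M_t^{(k)},m_t],\qquad \Psi_t^{(k)}=\mathsf E_{\mathcal R}[R^{-1};S_t^{(k)},s_t].$$ Let $\hat x_{t|t}$ be the last block of $\hat x^{(N)}_{t-T:t}$, and $\Phi_t=\Phi_t^{(N)}$, $\Psi_t=\Psi_t^{(N)}$, $M_t=M_t^{(N)}$, $S_t=S_t^{(N)}$, $\hat Q_t=\mathsf E_{\mathcal Q}[Q;M_t,m_t]$, $\hat R_t=\mathsf E_{\mathcal R}[R;S_t,s_t]$. (2) Set $\tilde x=A\bar x_{t-T}$,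 $\tilde P=A\bar P_{t-T}A'+\hat Q_t$, $K=\tilde PC'(C\tilde PC'+\hat R_t)^{-1}$, $\bar P_{t-T+1}=(I-KC)\tilde P$, $\bar x_{t-T+1}=\tilde x+K(y_{t-T+1}-C\tilde x)$, $\bar M_{t-T+1}=\rho M_t$, $\bar m_{t-T+1}=\rho(m_t-n_x-1)+n_x+1$, $\bar S_{t-T+1}=\rho S_t$, $\bar s_{t-T+1}=\rho(s_t-n_y-1)+n_y+1$. Any of the means $\mathsf E_{\mathcal S}[f;\Delta,\gamma]$ may be replaced by an importance-sampling approximation $$\frac{\sum_{j=1}^{J}f(G_j)\,\frac{\mathcal W^{-1}(G_j;\Delta,\gamma)}{\pi(G_j)}\mathbf 1_{\mathcal S}(G_j)}{\sum_{j=1}^{J}\frac{\mathcal W^{-1}(G_j;\Delta,\gamma)}{\pi(G_j)}\mathbf 1_{\mathcal S}(G_j)}$$ with any number $J$ of random samples $G_j$ and any (possibly random) proposal density $\pi$, positive at the samples in $\mathcal S$, provided that almost surely at least one of the samples lies in $\mathcal S$, so that the quotient is defined. **Theorem 1.** Assume that * (A1) $(A,C)$ is detectable; * (A2) there are $0<\underline\alpha\le\overline\alpha$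 with $\underline\alpha I\le Q\le\overline\alpha I$ for all $Q\in\mathcal Q$; * (A3) there are $0<\underline\beta\le\overline\beta$ with $\underline\beta I\le R\le\overline\beta I$ for all $R\in\mathcal R$. Then the estimation error $e_t=x_t-\hat x_{t|t}$ of the VB-MHE filter is uniformly bounded in mean square: there is a constant $c$ with $E[\|e_t\|^2]\le c<\infty$ for all $t\ge T$. This holds for any number $J$ of importance samples, any number $N\ge1$ of variational iterations and any window length $T\ge1$. -/

import Mathlib

open MeasureTheory ProbabilityTheory Matrix

noncomputable section

namespace VBMHE

/-- Real square matrices of size `d`. -/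
abbrev Mat (d : ℕ) := Matrix (Fin d) (Fin d) ℝ

/-- Real (column) vectors of dimension `d`; Euclidean norms are taken through `WithLp.toLp 2`. -/
abbrev Vec (d : ℕ) := Fin d → ℝ

/-- Entrywise (Borel) measurable structure on matrices. -/
instance matMeasurableSpace (m n : Type*) : MeasurableSpace (Matrix m n ℝ) :=
  inferInstanceAs (MeasurableSpace (m → n → ℝ))

/-- Detectability of the discrete-time pair `(A, C)`: some output injection `L` makes `A - L C`
Schur stable, i.e. all its complex eigenvalues lie in the open unit disc. -/
def Detectable {nx ny : ℕ} (A : Mat nx) (C : Matrix (Fin ny) (Fin nx) ℝ) : Prop :=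
  ∃ L : Matrix (Fin nx) (Fin ny) ℝ,
    ∀ z ∈ spectrum ℂ ((A - L * C).map (algebraMap ℝ ℂ)), ‖z‖ < 1

/-- `a I ≤ G ≤ b I` in the Loewner order, for every `G` in the set `𝒮`. -/
def LoewnerBounded {d : ℕ} (𝒮 : Set (Mat d)) (a b : ℝ) : Prop :=
  ∀ G ∈ 𝒮, (G - a • (1 : Mat d)).PosSemidef ∧ (b • (1 : Mat d) - G).PosSemidef

/-! ### Inverse Wishart densities and averages with respect to them -/

/-- Lebesgue measure on symmetric `d × d` matrices: the `d (d + 1) / 2` entries on and above the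
diagonal (indexed by unordered pairs) are the coordinates. -/
def symVolume (d : ℕ) : Measure (Mat d) :=
  Measure.map (fun (u : Sym2 (Fin d) → ℝ) => (Matrix.of fun i j => u s(i, j) : Mat d)) volume

/-- The multivariate gamma function `Γ_d(a) = π^{d(d-1)/4} ∏_{j=1}^d Γ(a + (1 - j)/2)`. -/
def multivariateGamma (d : ℕ) (a : ℝ) : ℝ :=
  Real.pi ^ ((d : ℝ) * ((d : ℝ) - 1) / 4) * ∏ j : Fin d, Real.Gamma (a - (j : ℝ) / 2)

/-- The inverse Wishart density `𝒲⁻¹(G; Δ, γ)` at a positive definite matrix `G`, with scale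
matrix `Δ` and `γ` degrees of freedom. It is only evaluated at positive definite `G`. -/
def invWishart {d : ℕ} (G Δ : Mat d) (γ : ℝ) : ℝ :=
  Δ.det ^ (γ / 2) / (2 ^ (γ * d / 2) * multivariateGamma d (γ / 2)) *
    G.det ^ (-(γ + d + 1) / 2) * Real.exp (-(Δ * G⁻¹).trace / 2)

/-- `∫_𝒮 f(G) 𝒲⁻¹(G; Δ, γ) dG / ∫_𝒮 𝒲⁻¹(G; Δ, γ) dG`, the mean of the matrix-valued `f` under
the inverse Wishart distribution constrained to `𝒮`. -/
def constrainedMean {d : ℕ} (𝒮 : Set (Mat d)) (f : Mat d → Mat d) (Δ : Mat d) (γ : ℝ) : Mat d :=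
  Matrix.of fun i j =>
    (∫ G in 𝒮, f G i j * invWishart G Δ γ ∂symVolume d) /
      ∫ G in 𝒮, invWishart G Δ γ ∂symVolume d

/-- The self-normalized importance sampling approximation of `constrainedMean` with `J` samples
`G j` and proposal density `π`. -/
def importanceMean {d J : ℕ} (𝒮 : Set (Mat d)) (G : Fin J → Mat d) (π : Mat d → ℝ)
    (f : Mat d → Mat d) (Δ : Mat d) (γ : ℝ) : Mat d :=
  (∑ j, 𝒮.indicator (fun H => invWishart H Δ γ / π H) (G j))⁻¹ •
    ∑ j, 𝒮.indicator (fun H => invWishart H Δ γ / π H) (G j) • f (G j)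

/-- The way in which one constrained mean is computed: exactly, or by importance sampling. The
samples and the proposal density are random; in particular they may depend on the measurements and
on earlier outputs of the filter. -/
inductive Integrator (Ω : Type*) (d : ℕ) where
  | exact : Integrator Ω d
  | sampled (J : ℕ) (G : Fin J → Ω → Mat d) (π : Ω → Mat d → ℝ) : Integrator Ω d

/-- The value that an integrator returns on the outcome `ω`. -/
def Integrator.mean {Ω : Type*} {d : ℕ} (I : Integrator Ω d) (ω : Ω) (𝒮 : Set (Mat d))
    (f : Mat d → Mat d) (Δ : Mat d) (γ : ℝ) : Mat d :=
  match I with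
  | .exact => constrainedMean 𝒮 f Δ γ
  | .sampled _ G π => importanceMean 𝒮 (fun j => G j ω) (π ω) f Δ γ

/-- Importance sampling is meaningful: samples and proposal density are measurable and, almost
surely, the density is positive at the samples in `𝒮` and the normalizing sum is not empty, i.e. at
least one sample lies in `𝒮`. Nothing is required of the law of the samples, so that samples drawn
from `π` are a special case. -/
def Integrator.Admissible {Ω : Type*} [MeasurableSpace Ω] {d : ℕ} (I : Integrator Ω d)
    (μ : Measure Ω) (𝒮 : Set (Mat d)) : Prop :=
  match I with
  | .exact => True
  | .sampled _ G π =>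
      (∀ j, Measurable (G j)) ∧ Measurable (Function.uncurry π) ∧
        ∀ᵐ ω ∂μ, (∀ j, G j ω ∈ 𝒮 → 0 < π ω (G j ω)) ∧ ∃ j, G j ω ∈ 𝒮

/-! ### The filter -/

/-- The design data of the filter: system matrices, admissible sets of covariances, window length
`T`, number `N` of variational iterations, forgetting factor `ρ`, parameters of the priors
of `x₀`, `Q`, `R`, and the integrators used for the initial `Φ`, `Ψ`, for `Φ_t^{(k)}`, `Ψ_t^{(k)}`
(time `t`, iteration `k`) and for `Q̂_t`, `R̂_t`. -/
structure VBFilter (Ω : Type*) (nx ny : ℕ) where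
  A : Mat nx
  C : Matrix (Fin ny) (Fin nx) ℝ
  𝒬 : Set (Mat nx)
  ℛ : Set (Mat ny)
  T : ℕ
  N : ℕ
  ρ : ℝ
  x₀ : Vec nx
  P₀ : Mat nx
  M₀ : Mat nx
  m₀ : ℝ
  S₀ : Mat ny
  s₀ : ℝ
  intΦ₀ : Integrator Ω nx
  intΨ₀ : Integrator Ω ny
  intΦ : ℕ → ℕ → Integrator Ω nx
  intΨ : ℕ → ℕ → Integrator Ω ny
  intQ : ℕ → Integrator Ω nx
  intR : ℕ → Integrator Ω ny

/-- The inputs of the algorithm at time `t`, besides the measurements: `x̄, P̄, M̄, m̄, S̄, s̄` at time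
`t - T`, and `Φ_{t-1}`, `Ψ_{t-1}`. -/
structure State (nx ny : ℕ) where
  x : Vec nx
  P : Mat nx
  M : Mat nx
  m : ℝ
  S : Mat ny
  s : ℝ
  Φ : Mat nx
  Ψ : Mat ny

/-- Vectors and matrices over a window of `T + 1` states. Block `a` belongs to time `t - T + a`, so
that the blocks are in increasing order of time. -/
abbrev WinVec (T d : ℕ) := Fin (T + 1) × Fin d → ℝ

/-- See `WinVec`. -/
abbrev WinMat (T d : ℕ) := Matrix (Fin (T + 1) × Fin d) (Fin (T + 1) × Fin d) ℝ

/-- The `a`-th block of a window vector. -/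
def WinVec.block {T d : ℕ} (x : WinVec T d) (a : Fin (T + 1)) : Vec d := fun i => x (a, i)

/-- The `(a, b)` block of a window matrix. -/
def WinMat.block {T d : ℕ} (P : WinMat T d) (a b : Fin (T + 1)) : Mat d :=
  Matrix.of fun i j => P (a, i) (b, j)

namespace VBFilter

variable {Ω : Type*} {nx ny : ℕ} (F : VBFilter Ω nx ny)

/-- The blocks of `Ω_t(Ψ, Φ)`, a block tridiagonal matrix; `P` is `P̄_{t-T}`. -/
def precisionBlock (P Φ : Mat nx) (Ψ : Mat ny) (a b : Fin (F.T + 1)) : Mat nx :=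
  if a = b then
    (if (a : ℕ) = 0 then P⁻¹ else F.Cᵀ * Ψ * F.C + Φ) +
      (if (a : ℕ) < F.T then F.Aᵀ * Φ * F.A else 0)
  else if (a : ℕ) = b + 1 then -(Φ * F.A)
  else if (b : ℕ) = a + 1 then -(F.Aᵀ * Φ)
  else 0

/-- The matrix `Ω_t(Ψ, Φ)`. -/
def precision (P Φ : Mat nx) (Ψ : Mat ny) : WinMat F.T nx :=
  Matrix.of fun p q => F.precisionBlock P Φ Ψ p.1 q.1 p.2 q.2

/-- The vector `ω_t(Ψ)`: blocks `C' Ψ y_{t-T+a}` for `a ≥ 1`, and `P̄_{t-T}⁻¹ x̄_{t-T}`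
for `a = 0`. -/
def infoVec (y : ℕ → Vec ny) (t : ℕ) (st : State nx ny) (Ψ : Mat ny) : WinVec F.T nx :=
  fun p => (if (p.1 : ℕ) = 0 then st.P⁻¹ *ᵥ st.x
    else (F.Cᵀ * Ψ) *ᵥ y (t - F.T + p.1)) p.2

/-- `P_{t-T:t} = Ω_t(Ψ, Φ)⁻¹`. -/
def winCov (st : State nx ny) (Φ : Mat nx) (Ψ : Mat ny) : WinMat F.T nx :=
  (F.precision st.P Φ Ψ)⁻¹

/-- `x̂_{t-T:t} = P_{t-T:t} ω_t(Ψ)`. -/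
def winMean (y : ℕ → Vec ny) (t : ℕ) (st : State nx ny) (Φ : Mat nx) (Ψ : Mat ny) :
    WinVec F.T nx :=
  F.winCov st Φ Ψ *ᵥ F.infoVec y t st Ψ

/-- `M_t(x̂, P)`: the sum runs over the `T` transitions inside the window. -/
def scaleM (st : State nx ny) (x : WinVec F.T nx) (P : WinMat F.T nx) : Mat nx :=
  st.M + ∑ i : Fin F.T,
    (vecMulVec (x.block i.succ - F.A *ᵥ x.block i.castSucc)
        (x.block i.succ - F.A *ᵥ x.block i.castSucc)
      + P.block i.succ i.succ + F.A * P.block i.castSucc i.castSucc * F.Aᵀ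
      - P.block i.succ i.castSucc * F.Aᵀ - F.A * P.block i.castSucc i.succ)

/-- `S_t(x̂, P)`: the sum runs over the `T` measurements inside the window. -/
def scaleS (y : ℕ → Vec ny) (t : ℕ) (st : State nx ny) (x : WinVec F.T nx)
    (P : WinMat F.T nx) : Mat ny :=
  st.S + ∑ i : Fin F.T,
    (vecMulVec (y (t - F.T + (i + 1)) - F.C *ᵥ x.block i.succ)
        (y (t - F.T + (i + 1)) - F.C *ᵥ x.block i.succ)
      + F.C * P.block i.succ i.succ * F.Cᵀ)

/-- `M_t` as obtained from the pair `(Φ, Ψ)` in one variational iteration. -/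
def iterM (y : ℕ → Vec ny) (t : ℕ) (st : State nx ny) (Φ : Mat nx) (Ψ : Mat ny) : Mat nx :=
  F.scaleM st (F.winMean y t st Φ Ψ) (F.winCov st Φ Ψ)

/-- `S_t` as obtained from the pair `(Φ, Ψ)` in one variational iteration. -/
def iterS (y : ℕ → Vec ny) (t : ℕ) (st : State nx ny) (Φ : Mat nx) (Ψ : Mat ny) : Mat ny :=
  F.scaleS y t st (F.winMean y t st Φ Ψ) (F.winCov st Φ Ψ)

/-- The pair `(Φ_t^{(k)}, Ψ_t^{(k)})`. -/
def variational (ω : Ω) (y : ℕ → Vec ny) (t : ℕ) (st : State nx ny) : ℕ → Mat nx × Mat ny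
  | 0 => (st.Φ, st.Ψ)
  | k + 1 =>
      let Φ := (variational ω y t st k).1
      let Ψ := (variational ω y t st k).2
      ((F.intΦ t (k + 1)).mean ω F.𝒬 (fun G => G⁻¹) (F.iterM y t st Φ Ψ) (st.m + F.T),
       (F.intΨ t (k + 1)).mean ω F.ℛ (fun G => G⁻¹) (F.iterS y t st Φ Ψ) (st.s + F.T))

/-- `Φ_t^{(N-1)}`. -/
def lastΦ (ω : Ω) (y : ℕ → Vec ny) (t : ℕ) (st : State nx ny) : Mat nx :=
  (F.variational ω y t st (F.N - 1)).1

/-- `Ψ_t^{(N-1)}`. -/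
def lastΨ (ω : Ω) (y : ℕ → Vec ny) (t : ℕ) (st : State nx ny) : Mat ny :=
  (F.variational ω y t st (F.N - 1)).2

/-- `M_t = M_t^{(N)}`. -/
def finalM (ω : Ω) (y : ℕ → Vec ny) (t : ℕ) (st : State nx ny) : Mat nx :=
  F.iterM y t st (F.lastΦ ω y t st) (F.lastΨ ω y t st)

/-- `S_t = S_t^{(N)}`. -/
def finalS (ω : Ω) (y : ℕ → Vec ny) (t : ℕ) (st : State nx ny) : Mat ny :=
  F.iterS y t st (F.lastΦ ω y t st) (F.lastΨ ω y t st)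

/-- `x̂_{t-T:t|t} = x̂_{t-T:t}^{(N)}`. -/
def finalMean (ω : Ω) (y : ℕ → Vec ny) (t : ℕ) (st : State nx ny) : WinVec F.T nx :=
  F.winMean y t st (F.lastΦ ω y t st) (F.lastΨ ω y t st)

/-- The covariance estimate `Q̂_t`. -/
def Qhat (ω : Ω) (y : ℕ → Vec ny) (t : ℕ) (st : State nx ny) : Mat nx :=
  (F.intQ t).mean ω F.𝒬 (fun G => G) (F.finalM ω y t st) (st.m + F.T)

/-- The covariance estimate `R̂_t`. -/
def Rhat (ω : Ω) (y : ℕ → Vec ny) (t : ℕ) (st : State nx ny) : Mat ny :=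
  (F.intR t).mean ω F.ℛ (fun G => G) (F.finalS ω y t st) (st.s + F.T)

/-- `P̃_{t-T+1} = A P̄_{t-T} A' + Q̂_t`. -/
def predCov (ω : Ω) (y : ℕ → Vec ny) (t : ℕ) (st : State nx ny) : Mat nx :=
  F.A * st.P * F.Aᵀ + F.Qhat ω y t st

/-- The Kalman gain `K_{t-T+1}`. -/
def gain (ω : Ω) (y : ℕ → Vec ny) (t : ℕ) (st : State nx ny) : Matrix (Fin nx) (Fin ny) ℝ :=
  F.predCov ω y t st * F.Cᵀ *
    (F.C * F.predCov ω y t st * F.Cᵀ + F.Rhat ω y t st)⁻¹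

/-- The update of the inputs of the algorithm from time `t` to time `t + 1`. -/
def update (ω : Ω) (y : ℕ → Vec ny) (t : ℕ) (st : State nx ny) : State nx ny where
  x := F.A *ᵥ st.x + F.gain ω y t st *ᵥ (y (t - F.T + 1) - F.C *ᵥ (F.A *ᵥ st.x))
  P := (1 - F.gain ω y t st * F.C) * F.predCov ω y t st
  M := F.ρ • F.finalM ω y t st
  m := F.ρ * (st.m + F.T - nx - 1) + nx + 1
  S := F.ρ • F.finalS ω y t st
  s := F.ρ * (st.s + F.T - ny - 1) + ny + 1
  Φ := (F.variational ω y t st F.N).1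
  Ψ := (F.variational ω y t st F.N).2

/-- The inputs of the algorithm at time `T + n`; at time `T` they come from the priors. -/
def state (ω : Ω) (y : ℕ → Vec ny) : ℕ → State nx ny
  | 0 =>
      { x := F.x₀, P := F.P₀, M := F.M₀, m := F.m₀, S := F.S₀, s := F.s₀
        Φ := F.intΦ₀.mean ω F.𝒬 (fun G => G⁻¹) F.M₀ F.m₀
        Ψ := F.intΨ₀.mean ω F.ℛ (fun G => G⁻¹) F.S₀ F.s₀ }
  | n + 1 => F.update ω y (F.T + n) (state ω y n)

/-- The filtered estimate `x̂_{t|t}`, for `t ≥ T`: the last block of `x̂_{t-T:t|t}`. -/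
def estimate (ω : Ω) (y : ℕ → Vec ny) (t : ℕ) : Vec nx :=
  (F.finalMean ω y t (F.state ω y (t - F.T))).block (Fin.last F.T)

/-- Standing assumptions on the design data: `𝒬`, `ℛ` are measurable sets of positive definite
matrices, of positive Lebesgue measure (so that the constrained priors exist); window length and
number of iterations are at least one; the forgetting factor is in `(0, 1)`; the priors are
nondegenerate; and all integrators are admissible. -/
structure Admissible [MeasurableSpace Ω] (μ : Measure Ω) : Prop where
  meas_𝒬 : MeasurableSet F.𝒬
  meas_ℛ : MeasurableSet F.ℛ
  posDef_𝒬 : ∀ G ∈ F.𝒬, G.PosDef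
  posDef_ℛ : ∀ G ∈ F.ℛ, G.PosDef
  vol_𝒬 : 0 < symVolume nx F.𝒬
  vol_ℛ : 0 < symVolume ny F.ℛ
  one_le_T : 1 ≤ F.T
  one_le_N : 1 ≤ F.N
  ρ_pos : 0 < F.ρ
  ρ_lt_one : F.ρ < 1
  posDef_P₀ : F.P₀.PosDef
  posDef_M₀ : F.M₀.PosDef
  posDef_S₀ : F.S₀.PosDef
  lt_m₀ : (nx : ℝ) + 1 < F.m₀
  lt_s₀ : (ny : ℝ) + 1 < F.s₀
  adm_Φ₀ : F.intΦ₀.Admissible μ F.𝒬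
  adm_Ψ₀ : F.intΨ₀.Admissible μ F.ℛ
  adm_Φ : ∀ t k, F.T ≤ t → 1 ≤ k → k ≤ F.N → (F.intΦ t k).Admissible μ F.𝒬
  adm_Ψ : ∀ t k, F.T ≤ t → 1 ≤ k → k ≤ F.N → (F.intΨ t k).Admissible μ F.ℛ
  adm_Q : ∀ t, F.T ≤ t → (F.intQ t).Admissible μ F.𝒬
  adm_R : ∀ t, F.T ≤ t → (F.intR t).Admissible μ F.ℛ

end VBFilter

/-! ### The system -/

/-- The random vectors `u`, `v` are uncorrelated: all cross-covariances of their components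
vanish. -/
def Uncorrelated {Ω : Type*} [MeasurableSpace Ω] (μ : Measure Ω) {d e : ℕ} (u : Ω → Vec d)
    (v : Ω → Vec e) : Prop :=
  ∀ i j, covariance (fun ω => u ω i) (fun ω => v ω j) μ = 0

/-- The random vector `u` has the law `𝒩(m, S)`. -/
def IsGaussianVec {Ω : Type*} [MeasurableSpace Ω] (μ : Measure Ω) {d : ℕ} (u : Ω → Vec d)
    (m : Vec d) (S : Mat d) : Prop :=
  HasLaw (fun ω => WithLp.toLp 2 (u ω)) (multivariateGaussian (WithLp.toLp 2 m) S) μ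

/-- The processes `x` (state, `t ≥ 0`) and `y` (measurements, `t ≥ 1`) follow
`x_{t+1} = A x_t + w_t`, `y_t = C x_t + v_t`, where `x₀ ~ 𝒩(x̄₀, P̄₀)` and `w_t ~ 𝒩(0, Q)`,
`v_t ~ 𝒩(0, R)` are white and uncorrelated with each other. -/
structure LinearGaussianSystem {Ω : Type*} [MeasurableSpace Ω] (μ : Measure Ω) {nx ny : ℕ}
    (A : Mat nx) (C : Matrix (Fin ny) (Fin nx) ℝ) (Q : Mat nx) (R : Mat ny)
    (x₀ : Vec nx) (P₀ : Mat nx)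
    (x : ℕ → Ω → Vec nx) (y : ℕ → Ω → Vec ny) (w : ℕ → Ω → Vec nx) (v : ℕ → Ω → Vec ny) :
    Prop where
  state_eq : ∀ t ω, x (t + 1) ω = A *ᵥ x t ω + w t ω
  meas_eq : ∀ t ω, 1 ≤ t → y t ω = C *ᵥ x t ω + v t ω
  law_x₀ : IsGaussianVec μ (x 0) x₀ P₀
  law_w : ∀ t, IsGaussianVec μ (w t) 0 Q
  law_v : ∀ t, 1 ≤ t → IsGaussianVec μ (v t) 0 R
  white_w : ∀ t s, t ≠ s → Uncorrelated μ (w t) (w s)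
  white_v : ∀ t s, 1 ≤ t → 1 ≤ s → t ≠ s → Uncorrelated μ (v t) (v s)
  uncorr : ∀ t s, 1 ≤ s → Uncorrelated μ (w t) (v s)

end VBMHE

end

/-
The proof follows the energy `eᵀ P⁻¹ e` of the error `e` of the prior mean at the start of the
window, where `P` is the prior covariance there. Every constrained mean is a convex average, exact
or sampled, so `Q̂`, `R̂`, `Φ`, `Ψ` stay between the Loewner bounds of (A2), (A3) whatever the
data. Detectability yields an output injection that stabilizes `A`, and comparison with this
suboptimal gain bounds the Riccati covariances `P` uniformly in time. Hence `A P Aᵀ + Q̂` exceeds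
`(1 + δ) A P Aᵀ` for a fixed `δ > 0`, and the energy contracts by a fixed factor at each step, up
to quadratic terms in the noises. The window cost is quadratic and minimal at the window estimate;
completing the square bounds the window error by the cost of the true trajectory, that is, by the
energy at the start of the window plus the noises inside it. Since both bounds hold pathwise, only
second moments of the noises enter when expectations are taken.
-/

noncomputable section

open scoped MatrixOrder Topology

namespace VBMHE

section LoewnerOrder

lemma posDef_of_smul_one_le {n : Type*} [DecidableEq n] {G : Matrix n n ℝ} {a : ℝ} (ha : 0 < a)
    (h : a • 1 ≤ G) : G.PosDef := by
  simpa using (PosDef.one.smul ha).add_posSemidef (le_iff.1 h)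

section

variable {m n : Type*} [Finite m] [Fintype n]

lemma mul_mul_transpose_nonneg {P : Matrix n n ℝ} (hP : 0 ≤ P) (H : Matrix m n ℝ) :
    0 ≤ H * P * Hᵀ := by
  rw [nonneg_iff_posSemidef] at hP ⊢
  simpa using hP.mul_mul_conjTranspose_same H

lemma mul_mul_transpose_mono {P Q : Matrix n n ℝ} (h : P ≤ Q) (H : Matrix m n ℝ) :
    H * P * Hᵀ ≤ H * Q * Hᵀ := by
  have := mul_mul_transpose_nonneg (sub_nonneg.2 h) H
  rwa [Matrix.mul_sub, Matrix.sub_mul, sub_nonneg] at this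

instance orderClosedTopology_matrix : OrderClosedTopology (Matrix m m ℝ) := by
  cases nonempty_fintype m
  refine ⟨?_⟩
  simp only [le_iff, posSemidef_iff_dotProduct_mulVec, Matrix.IsHermitian, Set.ofPred_and,
    Set.ofPred_forall]
  exact (isClosed_eq (by fun_prop) (by fun_prop)).inter
    (isClosed_iInter fun u => isClosed_le continuous_const (by fun_prop))

end

variable {m n : Type*} [Fintype m] [Fintype n]

lemma dotProduct_mulVec_eq_transpose_mulVec (M : Matrix m n ℝ) (u : m → ℝ) (v : n → ℝ) :
    u ⬝ᵥ M *ᵥ v = (Mᵀ *ᵥ u) ⬝ᵥ v := by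
  rw [dotProduct_mulVec, mulVec_transpose]

lemma dotProduct_conj_mulVec (H : Matrix m n ℝ) (P : Matrix n n ℝ) (u : m → ℝ) :
    u ⬝ᵥ (H * P * Hᵀ) *ᵥ u = (Hᵀ *ᵥ u) ⬝ᵥ P *ᵥ (Hᵀ *ᵥ u) := by
  rw [← mulVec_mulVec, ← mulVec_mulVec, dotProduct_mulVec_eq_transpose_mulVec]

lemma dotProduct_self_nonneg_real (u : n → ℝ) : 0 ≤ u ⬝ᵥ u := by
  simpa using dotProduct_star_self_nonneg u

lemma dotProduct_mulVec_nonneg {M : Matrix n n ℝ} (hM : M.PosSemidef) (u : n → ℝ) :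
    0 ≤ u ⬝ᵥ M *ᵥ u := by
  simpa using hM.dotProduct_mulVec_nonneg u

lemma dotProduct_mulVec_mono {M N : Matrix n n ℝ} (h : M ≤ N) (u : n → ℝ) :
    u ⬝ᵥ M *ᵥ u ≤ u ⬝ᵥ N *ᵥ u := by
  have := dotProduct_mulVec_nonneg (le_iff.1 h) u
  rwa [sub_mulVec, dotProduct_sub, sub_nonneg] at this

lemma le_of_dotProduct_mulVec_le {M N : Matrix n n ℝ} (hM : M.IsHermitian) (hN : N.IsHermitian)
    (h : ∀ u, u ⬝ᵥ M *ᵥ u ≤ u ⬝ᵥ N *ᵥ u) : M ≤ N :=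
  le_iff.2 <| .of_dotProduct_mulVec_nonneg (hN.sub hM) fun u => by
    simpa [sub_mulVec] using h u

lemma dotProduct_mulVec_comm {M : Matrix n n ℝ} (hM : M.IsHermitian) (u v : n → ℝ) :
    u ⬝ᵥ M *ᵥ v = v ⬝ᵥ M *ᵥ u := by
  rw [dotProduct_mulVec_eq_transpose_mulVec, dotProduct_comm, show Mᵀ = M from hM]

lemma dotProduct_mulVec_add_self {M : Matrix n n ℝ} (hM : M.IsHermitian) (u v : n → ℝ) :
    (u + v) ⬝ᵥ M *ᵥ (u + v) = u ⬝ᵥ M *ᵥ u + 2 * (v ⬝ᵥ M *ᵥ u) + v ⬝ᵥ M *ᵥ v := by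
  simp only [mulVec_add, dotProduct_add, add_dotProduct, dotProduct_mulVec_comm hM u v]
  ring

lemma two_mul_dotProduct_mulVec_le {M : Matrix n n ℝ} (hM : M.PosSemidef) (u v : n → ℝ) :
    2 * (u ⬝ᵥ M *ᵥ v) ≤ u ⬝ᵥ M *ᵥ u + v ⬝ᵥ M *ᵥ v := by
  have h := dotProduct_mulVec_nonneg hM (u - v)
  simp only [mulVec_sub, dotProduct_sub, sub_dotProduct,
    dotProduct_mulVec_comm hM.isHermitian v u] at h
  linarith

lemma add_dotProduct_self_le (u v : n → ℝ) :
    (u + v) ⬝ᵥ (u + v) ≤ 2 * (u ⬝ᵥ u) + 2 * (v ⬝ᵥ v) := by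
  have h := dotProduct_self_nonneg_real (u - v)
  simp only [sub_dotProduct, dotProduct_sub, add_dotProduct, dotProduct_add] at *
  linarith

lemma mulVec_dotProduct_self_le (M : Matrix m n ℝ) (u : n → ℝ) :
    (M *ᵥ u) ⬝ᵥ (M *ᵥ u) ≤ (Mᵀ * M).trace * (u ⬝ᵥ u) := by
  have htrace : (Mᵀ * M).trace = ∑ i, ∑ j, M i j ^ 2 := by
    rw [Finset.sum_comm]
    simp only [trace, diag_apply, mul_apply, transpose_apply, sq]
  rw [htrace, Finset.sum_mul]
  simp only [dotProduct, mulVec, ← sq]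
  exact Finset.sum_le_sum fun i _ => Finset.sum_mul_sq_le_sq_mul_sq Finset.univ (M i) u

variable [DecidableEq n]

lemma mulVec_inv_mulVec {P : Matrix n n ℝ} (hP : IsUnit P) (e : n → ℝ) : P *ᵥ (P⁻¹ *ᵥ e) = e := by
  rw [mulVec_mulVec, mul_nonsing_inv _ ((isUnit_iff_isUnit_det _).1 hP), one_mulVec]

lemma two_mul_dotProduct_le {P : Matrix n n ℝ} (hP : P.PosDef) (z e : n → ℝ) :
    2 * (z ⬝ᵥ e) ≤ z ⬝ᵥ P *ᵥ z + e ⬝ᵥ P⁻¹ *ᵥ e := by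
  have h := two_mul_dotProduct_mulVec_le hP.posSemidef z (P⁻¹ *ᵥ e)
  rwa [mulVec_inv_mulVec hP.isUnit, dotProduct_comm (P⁻¹ *ᵥ e)] at h

lemma dotProduct_inv_mulVec_le_of_forall {P : Matrix n n ℝ} (hP : P.PosDef) {e : n → ℝ} {c : ℝ}
    (h : ∀ z, 2 * (z ⬝ᵥ e) ≤ z ⬝ᵥ P *ᵥ z + c) : e ⬝ᵥ P⁻¹ *ᵥ e ≤ c := by
  have := h (P⁻¹ *ᵥ e)
  rw [mulVec_inv_mulVec hP.isUnit, dotProduct_comm] at this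
  linarith

lemma le_trace_smul_one {M : Matrix n n ℝ} (hM : 0 ≤ M) : M ≤ M.trace • 1 := by
  obtain ⟨B, rfl⟩ := CStarAlgebra.nonneg_iff_eq_star_mul_self.1 hM
  refine le_of_dotProduct_mulVec_le (isHermitian_conjTranspose_mul_self B)
    (isHermitian_one.smul (.all _)) fun u => ?_
  have h := mulVec_dotProduct_self_le B u
  simpa [star_eq_conjTranspose, ← mulVec_mulVec, dotProduct_mulVec_eq_transpose_mulVec,
    smul_mulVec] using h

lemma inv_smul_of_ne_zero {c : ℝ} (hc : c ≠ 0) {P : Matrix n n ℝ} (hP : IsUnit P) :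
    (c • P)⁻¹ = c⁻¹ • P⁻¹ :=
  Matrix.inv_smul' P (Units.mk0 c hc) ((isUnit_iff_isUnit_det _).1 hP)

-- Fenchel's inequality bounds `2 zᵀ(H f + L g)` through both terms of `zᵀ M z`.
lemma dotProduct_inv_mulVec_add_le [DecidableEq m] {k : Type*} [Fintype k] [DecidableEq k]
    {P : Matrix n n ℝ} {R : Matrix m m ℝ} {M : Matrix k k ℝ} (hP : P.PosDef) (hR : R.PosDef)
    (hM : M.PosDef) {H : Matrix k n ℝ} {L : Matrix k m ℝ} (h : H * P * Hᵀ + L * R * Lᵀ ≤ M)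
    (f : n → ℝ) (g : m → ℝ) :
    (H *ᵥ f + L *ᵥ g) ⬝ᵥ M⁻¹ *ᵥ (H *ᵥ f + L *ᵥ g) ≤ f ⬝ᵥ P⁻¹ *ᵥ f + g ⬝ᵥ R⁻¹ *ᵥ g := by
  refine dotProduct_inv_mulVec_le_of_forall hM fun z => ?_
  have hz := dotProduct_mulVec_mono h z
  rw [add_mulVec, dotProduct_add, dotProduct_conj_mulVec, dotProduct_conj_mulVec] at hz
  rw [dotProduct_add, dotProduct_mulVec_eq_transpose_mulVec, dotProduct_mulVec_eq_transpose_mulVec]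
  linarith [two_mul_dotProduct_le hP (Hᵀ *ᵥ z) f, two_mul_dotProduct_le hR (Lᵀ *ᵥ z) g]

lemma inv_anti_of_posDef {P Q : Matrix n n ℝ} (hP : P.PosDef) (h : P ≤ Q) : Q⁻¹ ≤ P⁻¹ := by
  have hQ : Q.PosDef := by simpa using hP.add_posSemidef (le_iff.1 h)
  refine le_of_dotProduct_mulVec_le hQ.inv.isHermitian hP.inv.isHermitian fun e =>
    dotProduct_inv_mulVec_le_of_forall hQ fun z => ?_
  linarith [two_mul_dotProduct_le hP z e, dotProduct_mulVec_mono h z]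

lemma inv_mem_Icc {a b : ℝ} (ha : 0 < a) (hb : 0 < b) {G : Matrix n n ℝ}
    (hG : G ∈ Set.Icc (a • (1 : Matrix n n ℝ)) (b • 1)) :
    G⁻¹ ∈ Set.Icc (b⁻¹ • (1 : Matrix n n ℝ)) (a⁻¹ • 1) := by
  have h1 := inv_anti_of_posDef (posDef_of_smul_one_le ha hG.1) hG.2
  have h2 := inv_anti_of_posDef (PosDef.one.smul ha) hG.1
  rw [inv_smul_of_ne_zero hb.ne' isUnit_one, inv_one] at h1
  rw [inv_smul_of_ne_zero ha.ne' isUnit_one, inv_one] at h2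
  exact ⟨h1, h2⟩

end LoewnerOrder

section Stability

-- By Gelfand's formula the norms of the powers decay geometrically.
lemma summable_norm_pow_of_spectralRadius_lt_one {R : Type*} [NormedRing R] [NormedAlgebra ℂ R]
    [CompleteSpace R] {a : R} (ha : spectralRadius ℂ a < 1) : Summable fun k : ℕ => ‖a ^ k‖ := by
  obtain ⟨r, har, hr⟩ := ENNReal.lt_iff_exists_nnreal_btwn.1 ha
  have hr1 : r < 1 := by exact_mod_cast hr
  refine .of_norm_bounded_eventually_nat (NNReal.summable_coe.2 (NNReal.summable_geometric hr1)) ?_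
  filter_upwards [(spectrum.pow_nnnorm_pow_one_div_tendsto_nhds_spectralRadius
    a).eventually_lt_const har, Filter.eventually_ne_atTop 0] with k hk hk0
  have h : (‖a ^ k‖₊ : ENNReal) ≤ (r : ENNReal) ^ (k : ℝ) := by
    rw [← ENNReal.rpow_inv_le_iff (by positivity), ← one_div]
    exact hk.le
  rw [norm_norm]
  exact_mod_cast h

attribute [local instance] Matrix.frobeniusNormedRing Matrix.frobeniusNormedAlgebra

variable {n : Type*} [Fintype n] [DecidableEq n]

lemma summable_norm_pow_of_spectrum_lt_one {F : Matrix n n ℝ}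
    (hF : ∀ z ∈ spectrum ℂ (F.map (algebraMap ℝ ℂ)), ‖z‖ < 1) : Summable fun k : ℕ => ‖F ^ k‖ := by
  cases isEmpty_or_nonempty n
  · exact summable_zero.congr fun k => by simp [Subsingleton.elim (F ^ k) 0]
  have : CompleteSpace (Matrix n n ℂ) := FiniteDimensional.complete ℂ _
  have hρ : spectralRadius ℂ (F.map (algebraMap ℝ ℂ)) < (1 : NNReal) :=
    spectrum.spectralRadius_lt_of_forall_lt _ fun z hz => NNReal.coe_lt_coe.1 (hF z hz)
  refine (summable_norm_pow_of_spectralRadius_lt_one hρ).congr fun k => ?_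
  have hmap : F.map (algebraMap ℝ ℂ) ^ k = (F ^ k).map (algebraMap ℝ ℂ) :=
    (map_pow (algebraMap ℝ ℂ).mapMatrix F k).symm
  rw [hmap]
  exact frobenius_norm_map_eq _ _ fun a => by simp

lemma exists_stein_solution {F : Matrix n n ℝ}
    (hF : ∀ z ∈ spectrum ℂ (F.map (algebraMap ℝ ℂ)), ‖z‖ < 1) :
    ∃ X : Matrix n n ℝ, 0 ≤ X ∧ F * X * Fᵀ + 1 = X := by
  have hF' := summable_norm_pow_of_spectrum_lt_one hF
  have hs : Summable fun k : ℕ => F ^ k * (F ^ k)ᵀ := by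
    refine .of_norm_bounded (hF'.mul_left (∑' k, ‖F ^ k‖)) fun k => ?_
    calc ‖F ^ k * (F ^ k)ᵀ‖ ≤ ‖F ^ k‖ * ‖(F ^ k)ᵀ‖ := norm_mul_le _ _
      _ = ‖F ^ k‖ * ‖F ^ k‖ := by rw [frobenius_norm_transpose]
      _ ≤ (∑' k, ‖F ^ k‖) * ‖F ^ k‖ := by
        gcongr; exact hF'.le_tsum k fun _ _ => norm_nonneg _
  refine ⟨∑' k, F ^ k * (F ^ k)ᵀ, tsum_nonneg fun k => ?_, ?_⟩
  · simpa using mul_mul_transpose_nonneg (zero_le_one (α := Matrix n n ℝ)) (F ^ k)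
  · rw [← hs.tsum_mul_left, ← (hs.mul_left F).tsum_mul_right, hs.tsum_eq_zero_add, add_comm]
    simp [pow_succ', Matrix.mul_assoc]

end Stability

section Kalman

lemma posDef_mul_mul_transpose_add {m n : Type*} [Finite m] [Fintype n] {P : Matrix n n ℝ}
    {R : Matrix m m ℝ} (C : Matrix m n ℝ) (hP : P.PosDef) (hR : R.PosDef) :
    (C * P * Cᵀ + R).PosDef :=
  .posSemidef_add (nonneg_iff_posSemidef.1
    (mul_mul_transpose_nonneg (nonneg_iff_posSemidef.2 hP.posSemidef) C)) hR

variable {k m n : Type*} [Fintype m] [Fintype n] [DecidableEq m]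

/-- The Kalman gain for the prior covariance `P`, the observation matrix `C` and the covariance
`R` of the observation noise. -/
def kalmanGain (C : Matrix m n ℝ) (P : Matrix n n ℝ) (R : Matrix m m ℝ) : Matrix n m ℝ :=
  P * Cᵀ * (C * P * Cᵀ + R)⁻¹

variable [DecidableEq n]

/-- The posterior covariance for the prior covariance `P`, the observation matrix `C` and the
covariance `R` of the observation noise. -/
def kalmanCov (C : Matrix m n ℝ) (P : Matrix n n ℝ) (R : Matrix m m ℝ) : Matrix n n ℝ :=
  (1 - kalmanGain C P R * C) * P

/-- One step of the Riccati recursion for the posterior covariance `P`: prediction with the system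
matrix `A` and the process noise covariance `Q`, followed by a measurement update. -/
def riccatiStep (A : Matrix n n ℝ) (C : Matrix m n ℝ) (Q : Matrix n n ℝ) (R : Matrix m m ℝ)
    (P : Matrix n n ℝ) : Matrix n n ℝ :=
  kalmanCov C (A * P * Aᵀ + Q) R

variable (A : Matrix n n ℝ) (C : Matrix m n ℝ) {P Q : Matrix n n ℝ} {R : Matrix m m ℝ}

-- Completion of squares in the gain: among all gains `L` for estimating `H x`, `H K` is optimal.
lemma sub_mul_mul_transpose_add_eq (hP : P.PosDef) (hR : R.PosDef) (H : Matrix k n ℝ)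
    (L : Matrix k m ℝ) :
    (H - L * C) * P * (H - L * C)ᵀ + L * R * Lᵀ =
      H * kalmanCov C P R * Hᵀ +
        (L - H * kalmanGain C P R) * (C * P * Cᵀ + R) * (L - H * kalmanGain C P R)ᵀ := by
  have hPsymm : Pᵀ = P := hP.isHermitian
  have hRsymm : Rᵀ = R := hR.isHermitian
  have hS := (isUnit_iff_isUnit_det _).1 (posDef_mul_mul_transpose_add C hP hR).isUnit
  have hKS : kalmanGain C P R * (C * P * Cᵀ + R) = P * Cᵀ := by
    rw [kalmanGain, Matrix.mul_assoc, nonsing_inv_mul _ hS, Matrix.mul_one]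
  have hSK : (C * P * Cᵀ + R) * (kalmanGain C P R)ᵀ = C * P := by
    have := congrArg Matrix.transpose hKS
    simpa only [transpose_mul, transpose_add, transpose_transpose, hPsymm, hRsymm,
      Matrix.mul_assoc] using this
  rw [kalmanCov]
  generalize kalmanGain C P R = K at hKS hSK ⊢
  have hsq : (L - H * K) * (C * P * Cᵀ + R) * (L - H * K)ᵀ =
      L * (C * P * Cᵀ + R) * Lᵀ - L * ((C * P * Cᵀ + R) * Kᵀ) * Hᵀ -
        H * (K * (C * P * Cᵀ + R)) * Lᵀ + H * (K * ((C * P * Cᵀ + R) * Kᵀ)) * Hᵀ := by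
    generalize C * P * Cᵀ + R = S
    simp only [transpose_sub, transpose_mul, Matrix.sub_mul, Matrix.mul_sub, Matrix.mul_assoc]
    abel
  rw [hsq, hSK, hKS]
  simp only [transpose_sub, transpose_mul, Matrix.sub_mul, Matrix.mul_sub, Matrix.add_mul,
    Matrix.mul_add, Matrix.mul_assoc, Matrix.one_mul]
  abel

lemma mul_kalmanCov_mul_transpose_le [Finite k] (hP : P.PosDef) (hR : R.PosDef)
    (H : Matrix k n ℝ) (L : Matrix k m ℝ) :
    H * kalmanCov C P R * Hᵀ ≤ (H - L * C) * P * (H - L * C)ᵀ + L * R * Lᵀ := by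
  have hS := (posDef_mul_mul_transpose_add C hP hR).posSemidef
  rw [sub_mul_mul_transpose_add_eq C hP hR]
  exact le_add_of_nonneg_right
    (mul_mul_transpose_nonneg (nonneg_iff_posSemidef.2 hS) _)

lemma kalmanCov_le (hP : P.PosDef) (hR : R.PosDef) : kalmanCov C P R ≤ P := by
  simpa using mul_kalmanCov_mul_transpose_le C hP hR (1 : Matrix n n ℝ) 0

lemma kalmanCov_eq_joseph_form (hP : P.PosDef) (hR : R.PosDef) :
    kalmanCov C P R = (1 - kalmanGain C P R * C) * P * (1 - kalmanGain C P R * C)ᵀ +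
      kalmanGain C P R * R * (kalmanGain C P R)ᵀ := by
  simpa using (sub_mul_mul_transpose_add_eq C hP hR (1 : Matrix n n ℝ) (kalmanGain C P R)).symm

lemma kalmanCov_posDef (hP : P.PosDef) (hR : R.PosDef) : (kalmanCov C P R).PosDef := by
  rw [kalmanCov_eq_joseph_form C hP hR]
  set K := kalmanGain C P R
  have hpsd := nonneg_iff_posSemidef.1 <| add_nonneg
    (mul_mul_transpose_nonneg (nonneg_iff_posSemidef.2 hP.posSemidef) (1 - K * C))
    (mul_mul_transpose_nonneg (nonneg_iff_posSemidef.2 hR.posSemidef) K)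
  refine .of_dotProduct_mulVec_pos hpsd.isHermitian fun z hz => ?_
  rw [star_trivial, add_mulVec, dotProduct_add, dotProduct_conj_mulVec, dotProduct_conj_mulVec]
  have hPz := dotProduct_mulVec_nonneg hP.posSemidef ((1 - K * C)ᵀ *ᵥ z)
  have hRz := dotProduct_mulVec_nonneg hR.posSemidef (Kᵀ *ᵥ z)
  by_cases hK : Kᵀ *ᵥ z = 0
  · have hKC : (1 - K * C)ᵀ *ᵥ z = z := by
      simp [transpose_sub, sub_mulVec, transpose_mul, ← mulVec_mulVec, hK]
    rw [hKC]
    exact add_pos_of_pos_of_nonneg (by simpa using hP.dotProduct_mulVec_pos hz) hRz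
  · exact add_pos_of_nonneg_of_pos hPz (by simpa using hR.dotProduct_mulVec_pos hK)

lemma riccatiStep_posDef (hP : P.PosDef) (hQ : Q.PosDef) (hR : R.PosDef) :
    (riccatiStep A C Q R P).PosDef :=
  kalmanCov_posDef C (posDef_mul_mul_transpose_add A hP hQ) hR

lemma riccatiStep_le (hP : P.PosDef) (hQ : Q.PosDef) (hR : R.PosDef) :
    riccatiStep A C Q R P ≤ A * P * Aᵀ + Q :=
  kalmanCov_le C (posDef_mul_mul_transpose_add A hP hQ) hR

-- This holds for arbitrary disturbances: the residual `v` is not assumed to be noise.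
lemma measurementUpdate_energy_le (hP : P.PosDef) (hR : R.PosDef) (e : n → ℝ) (v : m → ℝ) :
    let e' := (1 - kalmanGain C P R * C) *ᵥ e - kalmanGain C P R *ᵥ v
    e' ⬝ᵥ (kalmanCov C P R)⁻¹ *ᵥ e' ≤ e ⬝ᵥ P⁻¹ *ᵥ e + v ⬝ᵥ R⁻¹ *ᵥ v := by
  have h := dotProduct_inv_mulVec_add_le hP hR (kalmanCov_posDef C hP hR)
    (kalmanCov_eq_joseph_form C hP hR).ge e (-v)
  simpa [mulVec_neg, ← sub_eq_add_neg] using h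

lemma prediction_energy_le (hP : P.PosDef) (hQ : Q.PosDef) {a δ : ℝ} (ha : 0 < a) (hδ : 0 < δ)
    (hδP : δ • (A * P * Aᵀ) + a • 1 ≤ Q) (e w : n → ℝ) :
    (A *ᵥ e + w) ⬝ᵥ (A * P * Aᵀ + Q)⁻¹ *ᵥ (A *ᵥ e + w) ≤
      (1 + δ)⁻¹ * (e ⬝ᵥ P⁻¹ *ᵥ e) + a⁻¹ * (w ⬝ᵥ w) := by
  have hle : A * ((1 + δ) • P) * Aᵀ + 1 * (a • 1) * 1ᵀ ≤ A * P * Aᵀ + Q := by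
    simpa [add_smul, Matrix.mul_add, Matrix.add_mul, add_assoc] using hδP
  have h := dotProduct_inv_mulVec_add_le (hP.smul (by positivity : 0 < 1 + δ)) (PosDef.one.smul ha)
    (posDef_mul_mul_transpose_add A hP hQ) hle e w
  simpa [inv_smul_of_ne_zero (by positivity : 1 + δ ≠ 0) hP.isUnit,
    inv_smul_of_ne_zero ha.ne' isUnit_one, smul_mulVec] using h

lemma riccatiStep_energy_le (hP : P.PosDef) (hQ : Q.PosDef) {a β δ : ℝ} (ha : 0 < a) (hβ : 0 < β)
    (hR : β • 1 ≤ R) (hδ : 0 < δ) (hδP : δ • (A * P * Aᵀ) + a • 1 ≤ Q) {e e' w : n → ℝ} {v : m → ℝ}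
    (he' : e' = (1 - kalmanGain C (A * P * Aᵀ + Q) R * C) *ᵥ (A *ᵥ e + w) -
      kalmanGain C (A * P * Aᵀ + Q) R *ᵥ v) :
    e' ⬝ᵥ (riccatiStep A C Q R P)⁻¹ *ᵥ e' ≤
      (1 + δ)⁻¹ * (e ⬝ᵥ P⁻¹ *ᵥ e) + (a⁻¹ * (w ⬝ᵥ w) + β⁻¹ * (v ⬝ᵥ v)) := by
  subst he'
  have hRinv : R⁻¹ ≤ β⁻¹ • 1 := by
    simpa [inv_smul_of_ne_zero hβ.ne' isUnit_one] using
      inv_anti_of_posDef (PosDef.one.smul hβ) hR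
  have hv : v ⬝ᵥ R⁻¹ *ᵥ v ≤ β⁻¹ * (v ⬝ᵥ v) := by
    simpa [smul_mulVec] using dotProduct_mulVec_mono hRinv v
  have := measurementUpdate_energy_le C (posDef_mul_mul_transpose_add A hP hQ)
    (posDef_of_smul_one_le hβ hR) (A *ᵥ e + w) v
  rw [riccatiStep]
  linarith [prediction_energy_le A hP hQ ha hδ hδP e w]

-- With `F = A - L C` Schur stable, comparison with the suboptimal gain `L` gives
-- `A P⁺ Aᵀ ≤ F (A P Aᵀ + Q) Fᵀ + L R Lᵀ`; a multiple `Θ` of the Stein solution for `F` dominates.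
lemma exists_riccati_invariant_bound {nx ny : ℕ} {A : Mat nx} {C : Matrix (Fin ny) (Fin nx) ℝ}
    (hAC : Detectable A C) {b β : ℝ} (hb : 0 ≤ b) (hβ : 0 ≤ β) {P₀ : Mat nx} (hP₀ : 0 ≤ P₀) :
    ∃ Θ : Mat nx, A * P₀ * Aᵀ + b • 1 ≤ Θ ∧
      ∀ P Q R, P.PosDef → Q.PosDef → R.PosDef → Q ≤ b • 1 → R ≤ β • 1 → A * P * Aᵀ + b • 1 ≤ Θ →
        A * riccatiStep A C Q R P * Aᵀ + b • 1 ≤ Θ := by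
  obtain ⟨L, hL⟩ := hAC
  obtain ⟨X, hX, hstein⟩ := exists_stein_solution hL
  set F := A - L * C
  have hLL : 0 ≤ L * (β • (1 : Mat ny)) * Lᵀ :=
    mul_mul_transpose_nonneg (smul_nonneg hβ (zero_le_one (α := Mat ny))) L
  have hA : 0 ≤ A * P₀ * Aᵀ := mul_mul_transpose_nonneg hP₀ A
  set l := (L * (β • (1 : Mat ny)) * Lᵀ).trace
  set r := (A * P₀ * Aᵀ).trace
  have hl : 0 ≤ l := (nonneg_iff_posSemidef.1 hLL).trace_nonneg
  have hr : 0 ≤ r := (nonneg_iff_posSemidef.1 hA).trace_nonneg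
  have hX1 : 1 ≤ X := hstein ▸ le_add_of_nonneg_left (mul_mul_transpose_nonneg hX F)
  refine ⟨(l + r + b) • X, ?_, fun P Q R hP hQ hR hQb hRβ hPΘ => ?_⟩
  · calc A * P₀ * Aᵀ + b • 1 ≤ r • 1 + b • 1 := by gcongr; exact le_trace_smul_one hA
      _ ≤ (l + r + b) • 1 := by rw [← add_smul]; gcongr; linarith
      _ ≤ (l + r + b) • X := by gcongr
  · have hprior : A * P * Aᵀ + Q ≤ (l + r + b) • X := (by gcongr : _ ≤ _).trans hPΘ
    have hstep : A * riccatiStep A C Q R P * Aᵀ ≤ F * (A * P * Aᵀ + Q) * Fᵀ + L * R * Lᵀ :=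
      mul_kalmanCov_mul_transpose_le C (posDef_mul_mul_transpose_add A hP hQ) hR A L
    calc A * riccatiStep A C Q R P * Aᵀ + b • 1
        ≤ F * (A * P * Aᵀ + Q) * Fᵀ + L * R * Lᵀ + b • 1 := by gcongr
      _ ≤ F * ((l + r + b) • X) * Fᵀ + L * (β • (1 : Mat ny)) * Lᵀ + b • 1 := by
        gcongr ?_ + ?_ + _
        · exact mul_mul_transpose_mono hprior F
        · exact mul_mul_transpose_mono hRβ L
      _ ≤ F * ((l + r + b) • X) * Fᵀ + l • 1 + b • 1 := by gcongr; exact le_trace_smul_one hLL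
      _ ≤ F * ((l + r + b) • X) * Fᵀ + (l + r + b) • 1 := by
        rw [add_assoc, ← add_smul]; gcongr; linarith
      _ = (l + r + b) • X := by
        conv_rhs => rw [← hstein]
        simp

end Kalman

section Window

/-- The process noise that drives a window of states `u` of the system `x_{t+1} = A x_t + w_t`
from block `i` to block `i + 1`. -/
def WinVec.processNoise {T d : ℕ} (A : Mat d) (u : WinVec T d) (i : Fin T) : Vec d :=
  u.block i.succ - A *ᵥ u.block i.castSucc

lemma WinVec.block_add {T d : ℕ} (u z : WinVec T d) (a : Fin (T + 1)) :
    WinVec.block (u + z) a = u.block a + z.block a := rfl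

lemma WinVec.processNoise_add {T d : ℕ} (A : Mat d) (u z : WinVec T d) (i : Fin T) :
    WinVec.processNoise A (u + z) i = u.processNoise A i + z.processNoise A i := by
  simp only [WinVec.processNoise, WinVec.block_add, mulVec_add]
  abel

lemma WinVec.block_succ_eq {T d : ℕ} (A : Mat d) (u : WinVec T d) (i : Fin T) :
    u.block i.succ = A *ᵥ u.block i.castSucc + u.processNoise A i :=
  (add_sub_cancel _ _).symm

lemma WinVec.eq_zero_of_processNoise_eq_zero {T d : ℕ} {A : Mat d} {u : WinVec T d}
    (h0 : u.block 0 = 0) (h : ∀ i, u.processNoise A i = 0) : u = 0 := by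
  ext ⟨a, j⟩
  refine congrFun (?_ : u.block a = 0) j
  induction a using Fin.induction with
  | zero => exact h0
  | succ i ih => rw [u.block_succ_eq A, ih, h, mulVec_zero, add_zero]

lemma WinVec.exists_block_sq_le {T d : ℕ} (A : Mat d) (a : Fin (T + 1)) :
    ∃ κ : ℝ, 0 ≤ κ ∧ ∀ u : WinVec T d, u.block a ⬝ᵥ u.block a ≤
      κ * (u.block 0 ⬝ᵥ u.block 0 + ∑ i, u.processNoise A i ⬝ᵥ u.processNoise A i) := by
  have hnonneg : ∀ u : WinVec T d, ∀ i ∈ Finset.univ,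
      0 ≤ u.processNoise A i ⬝ᵥ u.processNoise A i := fun _ _ _ => dotProduct_self_nonneg_real _
  have htr : 0 ≤ (Aᵀ * A).trace := (posSemidef_conjTranspose_mul_self A).trace_nonneg
  induction a using Fin.induction with
  | zero =>
    refine ⟨1, zero_le_one, fun u => ?_⟩
    linarith [Finset.sum_nonneg (hnonneg u)]
  | succ i ih =>
    obtain ⟨κ, hκ, h⟩ := ih
    refine ⟨2 * ((Aᵀ * A).trace * κ) + 2, by positivity, fun u => ?_⟩
    have hsplit := add_dotProduct_self_le (A *ᵥ u.block i.castSucc) (u.processNoise A i)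
    rw [← u.block_succ_eq A] at hsplit
    have hA := mulVec_dotProduct_self_le A (u.block i.castSucc)
    have hprev := mul_le_mul_of_nonneg_left (h u) htr
    have hnoise := Finset.single_le_sum (hnonneg u) (Finset.mem_univ i)
    linarith [dotProduct_self_nonneg_real (u.block 0)]

lemma dotProduct_mulVec_eq_sum_block {T d : ℕ} (M : WinMat T d) (u z : WinVec T d) :
    u ⬝ᵥ M *ᵥ z = ∑ a, ∑ b, u.block a ⬝ᵥ M.block a b *ᵥ z.block b := by
  simp only [dotProduct, mulVec, WinVec.block, WinMat.block, Fintype.sum_prod_type, Matrix.of_apply]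
  refine Finset.sum_congr rfl fun a _ => ?_
  rw [Finset.sum_comm]
  exact Finset.sum_congr rfl fun i _ => Finset.mul_sum _ _ _

lemma sum_sum_ite_val_eq_succ {T : ℕ} (f : Fin (T + 1) → Fin (T + 1) → ℝ) :
    ∑ a : Fin (T + 1), ∑ b : Fin (T + 1), (if (a : ℕ) = b + 1 then f a b else 0) =
      ∑ i : Fin T, f i.succ i.castSucc := by
  rw [Fin.sum_univ_succ]
  have hzero : ∑ b : Fin (T + 1), (if ((0 : Fin (T + 1)) : ℕ) = b + 1 then f 0 b else 0) = 0 :=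
    Finset.sum_eq_zero fun b _ => by simp
  rw [hzero, zero_add]
  refine Finset.sum_congr rfl fun i _ => ?_
  have hiff : ∀ b : Fin (T + 1), (i.succ : ℕ) = b + 1 ↔ i.castSucc = b := fun b => by
    simp [Fin.ext_iff]
  simp only [hiff, Finset.sum_ite_eq, Finset.mem_univ, if_true]

/-- The energy `‖x - x̄‖²` in the metric `P̄⁻¹` of the error that the filter state `st` makes in
estimating `x`; it is the Lyapunov function of the filter. -/
def State.energy {nx ny : ℕ} (st : State nx ny) (x : Vec nx) : ℝ :=
  (x - st.x) ⬝ᵥ st.P⁻¹ *ᵥ (x - st.x)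

lemma State.energy_nonneg {nx ny : ℕ} {st : State nx ny} (hP : st.P.PosSemidef) (x : Vec nx) :
    0 ≤ st.energy x :=
  dotProduct_mulVec_nonneg hP.inv _

namespace VBFilter

variable {Ω : Type*} {nx ny : ℕ} (F : VBFilter Ω nx ny)

lemma dotProduct_precisionBlock_mulVec (P Φ : Mat nx) (Ψ : Mat ny) (a b : Fin (F.T + 1))
    (u z : Vec nx) :
    u ⬝ᵥ F.precisionBlock P Φ Ψ a b *ᵥ z =
      (if a = b then
        (if (a : ℕ) = 0 then u ⬝ᵥ P⁻¹ *ᵥ z else u ⬝ᵥ (F.Cᵀ * Ψ * F.C + Φ) *ᵥ z) +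
          (if (a : ℕ) < F.T then u ⬝ᵥ (F.Aᵀ * Φ * F.A) *ᵥ z else 0) else 0) +
      (if (a : ℕ) = b + 1 then -(u ⬝ᵥ (Φ * F.A) *ᵥ z) else 0) +
      (if (b : ℕ) = a + 1 then -(u ⬝ᵥ (F.Aᵀ * Φ) *ᵥ z) else 0) := by
  unfold precisionBlock
  simp only [Fin.ext_iff]
  split_ifs <;> first | omega | simp [add_mulVec, neg_mulVec]

lemma dotProduct_precision_mulVec (P Φ : Mat nx) (Ψ : Mat ny) (u z : WinVec F.T nx) :
    u ⬝ᵥ F.precision P Φ Ψ *ᵥ z = u.block 0 ⬝ᵥ P⁻¹ *ᵥ z.block 0 +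
      ∑ i, (u.processNoise F.A i ⬝ᵥ Φ *ᵥ z.processNoise F.A i +
        (F.C *ᵥ u.block i.succ) ⬝ᵥ Ψ *ᵥ (F.C *ᵥ z.block i.succ)) := by
  have hblock : ∀ a b, (F.precision P Φ Ψ).block a b = F.precisionBlock P Φ Ψ a b :=
    fun _ _ => rfl
  simp only [dotProduct_mulVec_eq_sum_block, hblock, dotProduct_precisionBlock_mulVec,
    Finset.sum_add_distrib, Finset.sum_ite_eq, Finset.mem_univ, if_true]
  rw [sum_sum_ite_val_eq_succ fun a b => -(u.block a ⬝ᵥ (Φ * F.A) *ᵥ z.block b),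
    Finset.sum_comm (f := fun a b => ite _ (-(u.block a ⬝ᵥ (F.Aᵀ * Φ) *ᵥ z.block b)) 0),
    sum_sum_ite_val_eq_succ fun b a => -(u.block a ⬝ᵥ (F.Aᵀ * Φ) *ᵥ z.block b),
    Fin.sum_univ_succ]
  conv_lhs => enter [1, 1, 2]; rw [Fin.sum_univ_castSucc]
  simp only [Fin.val_zero, if_true, Fin.val_succ, Nat.succ_ne_zero, if_false, Fin.val_castSucc,
    Fin.is_lt, Fin.val_last, lt_irrefl, add_zero, add_assoc, ← Finset.sum_add_distrib]
  congr 1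
  refine Finset.sum_congr rfl fun i _ => ?_
  simp only [WinVec.processNoise, add_mulVec, dotProduct_add, ← mulVec_mulVec, mulVec_sub,
    dotProduct_sub, sub_dotProduct, dotProduct_mulVec_eq_transpose_mulVec F.Cᵀ,
    dotProduct_mulVec_eq_transpose_mulVec F.Aᵀ, transpose_transpose]
  ring

lemma dotProduct_infoVec (y : ℕ → Vec ny) (t : ℕ) (st : State nx ny) (Ψ : Mat ny)
    (u : WinVec F.T nx) :
    u ⬝ᵥ F.infoVec y t st Ψ = u.block 0 ⬝ᵥ st.P⁻¹ *ᵥ st.x +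
      ∑ i : Fin F.T, (F.C *ᵥ u.block i.succ) ⬝ᵥ Ψ *ᵥ y (t - F.T + (i + 1)) := by
  have hblock : u ⬝ᵥ F.infoVec y t st Ψ = ∑ a : Fin (F.T + 1), u.block a ⬝ᵥ
      (if (a : ℕ) = 0 then st.P⁻¹ *ᵥ st.x else (F.Cᵀ * Ψ) *ᵥ y (t - F.T + a)) := by
    simp only [dotProduct, WinVec.block, Fintype.sum_prod_type, infoVec]
  simp [hblock, Fin.sum_univ_succ, ← mulVec_mulVec, dotProduct_mulVec_eq_transpose_mulVec F.Cᵀ]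

variable {P Φ : Mat nx} {Ψ : Mat ny}

lemma dotProduct_precision_mulVec_comm (hP : P.IsHermitian) (hΦ : Φ.IsHermitian)
    (hΨ : Ψ.IsHermitian) (u z : WinVec F.T nx) :
    u ⬝ᵥ F.precision P Φ Ψ *ᵥ z = z ⬝ᵥ F.precision P Φ Ψ *ᵥ u := by
  simp only [dotProduct_precision_mulVec, dotProduct_mulVec_comm hP.inv,
    dotProduct_mulVec_comm hΦ (u.processNoise F.A _),
    dotProduct_mulVec_comm hΨ (F.C *ᵥ u.block _)]

lemma precision_posDef (hP : P.PosDef) (hΦ : Φ.PosDef) (hΨ : Ψ.PosDef) :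
    (F.precision P Φ Ψ).PosDef := by
  have hsymm := F.dotProduct_precision_mulVec_comm hP.isHermitian hΦ.isHermitian hΨ.isHermitian
  refine .of_dotProduct_mulVec_pos ?_ fun (u : WinVec F.T nx) hu => ?_
  · ext p q
    simpa using hsymm (Pi.single q 1) (Pi.single p 1)
  rw [star_trivial, dotProduct_precision_mulVec]
  have hinit := dotProduct_mulVec_nonneg hP.inv.posSemidef (u.block 0)
  have hmeas := fun i : Fin F.T => dotProduct_mulVec_nonneg hΨ.posSemidef (F.C *ᵥ u.block i.succ)
  have hnoise := fun i => dotProduct_mulVec_nonneg hΦ.posSemidef (u.processNoise F.A i)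
  have hterm := fun i (_ : i ∈ Finset.univ) => add_nonneg (hnoise i) (hmeas i)
  have hsum := Finset.sum_nonneg hterm
  contrapose! hu
  refine WinVec.eq_zero_of_processNoise_eq_zero (A := F.A)
    (by_contra fun hne => ?_) fun i => by_contra fun hne => ?_
  · have : 0 < u.block 0 ⬝ᵥ P⁻¹ *ᵥ u.block 0 := by simpa using hP.inv.dotProduct_mulVec_pos hne
    linarith
  · have : 0 < u.processNoise F.A i ⬝ᵥ Φ *ᵥ u.processNoise F.A i := by
      simpa using hΦ.dotProduct_mulVec_pos hne
    linarith [Finset.single_le_sum hterm (Finset.mem_univ i), hmeas i]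

lemma winCov_posDef {st : State nx ny} (hP : st.P.PosDef) (hΦ : Φ.PosDef) (hΨ : Ψ.PosDef) :
    (F.winCov st Φ Ψ).PosDef :=
  (F.precision_posDef hP hΦ hΨ).inv

/-- Twice the cost function that `winMean` minimizes. -/
def winCost (y : ℕ → Vec ny) (t : ℕ) (st : State nx ny) (Φ : Mat nx) (Ψ : Mat ny)
    (u : WinVec F.T nx) : ℝ :=
  st.energy (u.block 0) +
    ∑ i, (u.processNoise F.A i ⬝ᵥ Φ *ᵥ u.processNoise F.A i +
      (y (t - F.T + (i + 1)) - F.C *ᵥ u.block i.succ) ⬝ᵥ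
        Ψ *ᵥ (y (t - F.T + (i + 1)) - F.C *ᵥ u.block i.succ))

variable (y : ℕ → Vec ny) (t : ℕ) {st : State nx ny}

lemma winCost_nonneg (hP : st.P.PosSemidef) (hΦ : Φ.PosSemidef) (hΨ : Ψ.PosSemidef)
    (u : WinVec F.T nx) : 0 ≤ F.winCost y t st Φ Ψ u :=
  add_nonneg (State.energy_nonneg hP _) <| Finset.sum_nonneg fun _ _ =>
    add_nonneg (dotProduct_mulVec_nonneg hΦ _) (dotProduct_mulVec_nonneg hΨ _)

lemma winCost_add (hP : st.P.IsHermitian) (hΦ : Φ.IsHermitian) (hΨ : Ψ.IsHermitian)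
    (z u : WinVec F.T nx) :
    F.winCost y t st Φ Ψ (z + u) = F.winCost y t st Φ Ψ z +
      2 * (u ⬝ᵥ (F.precision st.P Φ Ψ *ᵥ z - F.infoVec y t st Ψ)) +
        u ⬝ᵥ F.precision st.P Φ Ψ *ᵥ u := by
  have hinit : st.energy (WinVec.block (z + u) 0) = st.energy (z.block 0) +
        2 * (u.block 0 ⬝ᵥ st.P⁻¹ *ᵥ z.block 0 - u.block 0 ⬝ᵥ st.P⁻¹ *ᵥ st.x) +
          u.block 0 ⬝ᵥ st.P⁻¹ *ᵥ u.block 0 := by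
    rw [State.energy, State.energy, WinVec.block_add, add_sub_right_comm,
      dotProduct_mulVec_add_self hP.inv, ← dotProduct_sub, ← mulVec_sub]
  have hmeas : ∀ (b : Vec ny) (i : Fin F.T),
      (b - F.C *ᵥ WinVec.block (z + u) i.succ) ⬝ᵥ Ψ *ᵥ
          (b - F.C *ᵥ WinVec.block (z + u) i.succ) =
        (b - F.C *ᵥ z.block i.succ) ⬝ᵥ Ψ *ᵥ (b - F.C *ᵥ z.block i.succ) +
          2 * ((F.C *ᵥ u.block i.succ) ⬝ᵥ Ψ *ᵥ (F.C *ᵥ z.block i.succ) -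
            (F.C *ᵥ u.block i.succ) ⬝ᵥ Ψ *ᵥ b) +
          (F.C *ᵥ u.block i.succ) ⬝ᵥ Ψ *ᵥ (F.C *ᵥ u.block i.succ) := fun b i => by
    rw [WinVec.block_add, mulVec_add, ← sub_sub, sub_eq_add_neg _ (F.C *ᵥ u.block i.succ),
      dotProduct_mulVec_add_self hΨ, mulVec_neg, neg_dotProduct_neg, neg_dotProduct, mulVec_sub Ψ,
      dotProduct_sub (F.C *ᵥ u.block i.succ)]
    ring
  rw [dotProduct_sub, dotProduct_infoVec]
  simp only [dotProduct_precision_mulVec, winCost, hinit, hmeas, WinVec.processNoise_add,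
    dotProduct_mulVec_add_self hΦ, Finset.sum_add_distrib, Finset.sum_sub_distrib,
    ← Finset.mul_sum]
  ring

lemma winCost_le {φ ψ : ℝ} (hΦ : Φ ≤ φ • 1) (hΨ : Ψ ≤ ψ • 1) (u : WinVec F.T nx) :
    F.winCost y t st Φ Ψ u ≤ st.energy (u.block 0) +
      ∑ i, (φ * (u.processNoise F.A i ⬝ᵥ u.processNoise F.A i) +
        ψ * ((y (t - F.T + (i + 1)) - F.C *ᵥ u.block i.succ) ⬝ᵥ
          (y (t - F.T + (i + 1)) - F.C *ᵥ u.block i.succ))) := by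
  unfold winCost
  gcongr with i
  · simpa [smul_mulVec] using dotProduct_mulVec_mono hΦ (u.processNoise F.A i)
  · simpa only [smul_mulVec, one_mulVec, dotProduct_smul, smul_eq_mul] using
      dotProduct_mulVec_mono hΨ (y (t - F.T + (i + 1)) - F.C *ᵥ u.block i.succ)

lemma precision_mulVec_winMean (hP : st.P.PosDef) (hΦ : Φ.PosDef) (hΨ : Ψ.PosDef) :
    F.precision st.P Φ Ψ *ᵥ F.winMean y t st Φ Ψ = F.infoVec y t st Ψ :=
  mulVec_inv_mulVec (F.precision_posDef hP hΦ hΨ).isUnit _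

lemma winError_energy_le_winCost (hP : st.P.PosDef) (hΦ : Φ.PosDef) (hΨ : Ψ.PosDef)
    (u : WinVec F.T nx) :
    (u - F.winMean y t st Φ Ψ) ⬝ᵥ F.precision st.P Φ Ψ *ᵥ (u - F.winMean y t st Φ Ψ) ≤
      F.winCost y t st Φ Ψ u := by
  have h := F.winCost_add y t hP.isHermitian hΦ.isHermitian hΨ.isHermitian
    (F.winMean y t st Φ Ψ) (u - F.winMean y t st Φ Ψ)
  rw [F.precision_mulVec_winMean y t hP hΦ hΨ, sub_self, dotProduct_zero, add_sub_cancel] at h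
  linarith [F.winCost_nonneg y t hP.posSemidef hΦ.posSemidef hΨ.posSemidef (F.winMean y t st Φ Ψ)]

lemma sq_block_zero_add_sum_le {p φ : ℝ} (hp : 0 < p) (hφ : 0 < φ) (hP : P.PosDef)
    (hPp : P ≤ p • 1) (hΦ : φ • 1 ≤ Φ) (hΨ : Ψ.PosSemidef) (u : WinVec F.T nx) :
    u.block 0 ⬝ᵥ u.block 0 + ∑ i, u.processNoise F.A i ⬝ᵥ u.processNoise F.A i ≤
      (p + φ⁻¹) * (u ⬝ᵥ F.precision P Φ Ψ *ᵥ u) := by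
  have hinit : u.block 0 ⬝ᵥ u.block 0 ≤ p * (u.block 0 ⬝ᵥ P⁻¹ *ᵥ u.block 0) := by
    have := dotProduct_mulVec_mono (inv_anti_of_posDef hP hPp) (u.block 0)
    rw [inv_smul_of_ne_zero hp.ne' isUnit_one, inv_one, smul_mulVec, one_mulVec, dotProduct_smul,
      smul_eq_mul] at this
    rwa [← inv_mul_le_iff₀ hp]
  have hnoise : ∀ i, u.processNoise F.A i ⬝ᵥ u.processNoise F.A i ≤
      φ⁻¹ * (u.processNoise F.A i ⬝ᵥ Φ *ᵥ u.processNoise F.A i +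
        (F.C *ᵥ u.block i.succ) ⬝ᵥ Ψ *ᵥ (F.C *ᵥ u.block i.succ)) := fun i => by
    have := dotProduct_mulVec_mono hΦ (u.processNoise F.A i)
    rw [smul_mulVec, one_mulVec, dotProduct_smul, smul_eq_mul] at this
    rw [le_inv_mul_iff₀ hφ]
    linarith [dotProduct_mulVec_nonneg hΨ (F.C *ᵥ u.block i.succ)]
  have hnonneg := dotProduct_mulVec_nonneg hP.inv.posSemidef (u.block 0)
  have hsum_nonneg : 0 ≤ ∑ i, u.processNoise F.A i ⬝ᵥ u.processNoise F.A i :=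
    Finset.sum_nonneg fun _ _ => dotProduct_self_nonneg_real _
  have hsum := Finset.sum_le_sum fun i (_ : i ∈ Finset.univ) => hnoise i
  rw [← Finset.mul_sum] at hsum
  rw [dotProduct_precision_mulVec, add_mul, mul_add, mul_add]
  have hφ' := inv_pos.2 hφ
  have := mul_nonneg hφ'.le hnonneg
  have := mul_nonneg hp.le ((mul_nonneg_iff_of_pos_left hφ').1 (hsum_nonneg.trans hsum))
  linarith

lemma exists_winError_le {p φ : ℝ} (hp : 0 < p) (hφ : 0 < φ) :
    ∃ κ : ℝ, 0 ≤ κ ∧ ∀ (y : ℕ → Vec ny) (t : ℕ) (st : State nx ny) (Φ : Mat nx) (Ψ : Mat ny)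
      (u : WinVec F.T nx), st.P.PosDef → st.P ≤ p • 1 → φ • 1 ≤ Φ → Ψ.PosDef →
      (WinVec.block (u - F.winMean y t st Φ Ψ) (Fin.last F.T)) ⬝ᵥ
        (WinVec.block (u - F.winMean y t st Φ Ψ) (Fin.last F.T)) ≤
      κ * F.winCost y t st Φ Ψ u := by
  obtain ⟨κ, hκ, hblock⟩ := WinVec.exists_block_sq_le F.A (Fin.last F.T)
  refine ⟨κ * (p + φ⁻¹), by positivity, fun y t st Φ Ψ u hP hPp hΦ hΨ => ?_⟩
  set e := u - F.winMean y t st Φ Ψ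
  calc e.block (Fin.last F.T) ⬝ᵥ e.block (Fin.last F.T)
      ≤ κ * (e.block 0 ⬝ᵥ e.block 0 + ∑ i, e.processNoise F.A i ⬝ᵥ e.processNoise F.A i) :=
        hblock e
    _ ≤ κ * ((p + φ⁻¹) * (e ⬝ᵥ F.precision st.P Φ Ψ *ᵥ e)) := by
        gcongr; exact F.sq_block_zero_add_sum_le hp hφ hP hPp hΦ hΨ.posSemidef e
    _ ≤ κ * ((p + φ⁻¹) * F.winCost y t st Φ Ψ u) := by
        gcongr; exact F.winError_energy_le_winCost y t hP (posDef_of_smul_one_le hφ hΦ) hΨ u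
    _ = κ * (p + φ⁻¹) * F.winCost y t st Φ Ψ u := (mul_assoc _ _ _).symm

end VBFilter

end Window

section ScaleMatrices

/-- The matrix that maps a window vector to its block `a`. -/
def blockSelector (T d : ℕ) (a : Fin (T + 1)) : Matrix (Fin d) (Fin (T + 1) × Fin d) ℝ :=
  (1 : WinMat T d).submatrix (fun i => (a, i)) id

lemma WinMat.block_eq_mul_mul_transpose {T d : ℕ} (P : WinMat T d) (a b : Fin (T + 1)) :
    P.block a b = blockSelector T d a * P * (blockSelector T d b)ᵀ := by
  ext i j
  simp [WinMat.block, blockSelector, Matrix.mul_apply, Matrix.one_apply]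

-- This is the covariance of the process noise `x_{i+1} - A x_i` when the window has covariance `P`.
lemma posSemidef_transition {T d : ℕ} {P : WinMat T d} (hP : P.PosSemidef) (A : Mat d)
    (i : Fin T) :
    (P.block i.succ i.succ + A * P.block i.castSucc i.castSucc * Aᵀ
      - P.block i.succ i.castSucc * Aᵀ - A * P.block i.castSucc i.succ).PosSemidef := by
  convert hP.mul_mul_conjTranspose_same
    (blockSelector T d i.succ - A * blockSelector T d i.castSucc) using 1
  simp only [WinMat.block_eq_mul_mul_transpose, conjTranspose_eq_transpose_of_trivial,
    transpose_sub, transpose_mul, Matrix.sub_mul, Matrix.mul_sub, Matrix.mul_assoc]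
  abel

lemma posSemidef_vecMulVec_self {d : ℕ} (u : Vec d) : (vecMulVec u u).PosSemidef := by
  simpa using posSemidef_vecMulVec_self_star u

namespace VBFilter

variable {Ω : Type*} {nx ny : ℕ} (F : VBFilter Ω nx ny) {st : State nx ny}

lemma scaleM_posDef (hM : st.M.PosDef) (x : WinVec F.T nx) {P : WinMat F.T nx}
    (hP : P.PosSemidef) : (F.scaleM st x P).PosDef :=
  hM.add_posSemidef <| posSemidef_sum _ fun i _ => by
    simpa only [add_sub_assoc, add_assoc] using
      (posSemidef_vecMulVec_self _).add (posSemidef_transition hP F.A i)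

lemma scaleS_posDef (y : ℕ → Vec ny) (t : ℕ) (hS : st.S.PosDef) (x : WinVec F.T nx)
    {P : WinMat F.T nx} (hP : P.PosSemidef) : (F.scaleS y t st x P).PosDef :=
  hS.add_posSemidef <| posSemidef_sum _ fun i _ =>
    have hblock : (P.block i.succ i.succ).PosSemidef := hP.submatrix fun j => (i.succ, j)
    (posSemidef_vecMulVec_self _).add (by simpa using hblock.mul_mul_conjTranspose_same F.C)

end VBFilter

end ScaleMatrices

section MatrixTopology

variable {m n : Type*}

instance borelSpace_matrix [Countable m] [Countable n] : BorelSpace (Matrix m n ℝ) :=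
  inferInstanceAs (BorelSpace (m → n → ℝ))

lemma measurable_matrix_elem (i : m) (j : n) : Measurable fun G : Matrix m n ℝ => G i j :=
  (measurable_pi_apply j).comp (measurable_pi_apply i)

lemma measurable_matrix_of {X : Type*} [MeasurableSpace X] {f : X → Matrix m n ℝ}
    (hf : ∀ i j, Measurable fun x => f x i j) : Measurable f :=
  measurable_pi_iff.2 fun i => measurable_pi_iff.2 (hf i)

lemma matrix_inv_eq_inv_det_smul_adjugate [Fintype n] [DecidableEq n] (G : Matrix n n ℝ) :
    G⁻¹ = (G.det)⁻¹ • G.adjugate := by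
  rw [Matrix.inv_def, Ring.inverse_eq_inv']

lemma measurable_matrix_inv [Fintype n] [DecidableEq n] :
    Measurable fun G : Matrix n n ℝ => G⁻¹ := by
  simp only [matrix_inv_eq_inv_det_smul_adjugate]
  exact measurable_matrix_of fun i j =>
    (continuous_id.matrix_det.measurable.inv).mul
      (continuous_id.matrix_adjugate.matrix_elem i j).measurable

lemma continuousOn_matrix_inv [Fintype n] [DecidableEq n] :
    ContinuousOn (fun G : Matrix n n ℝ => G⁻¹) {G | G.PosDef} := by
  simp only [matrix_inv_eq_inv_det_smul_adjugate]
  have hdet : Continuous fun G : Matrix n n ℝ => G.det := continuous_id.matrix_det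
  have hadj : Continuous fun G : Matrix n n ℝ => G.adjugate := continuous_id.matrix_adjugate
  exact (hdet.continuousOn.inv₀ fun G hG => (PosDef.det_pos hG).ne').smul hadj.continuousOn

lemma abs_apply_le_trace [Fintype n] {G : Matrix n n ℝ} (hG : 0 ≤ G) (i j : n) :
    |G i j| ≤ G.trace := by
  classical
  have hG := Matrix.nonneg_iff_posSemidef.1 hG
  have hdiag (k) : G k k ≤ G.trace :=
    Finset.single_le_sum (f := fun k => G k k) (fun k _ => hG.diag_nonneg) (Finset.mem_univ k)
  have hsymm : G j i = G i j := hG.isHermitian.apply i j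
  have hadd := dotProduct_mulVec_nonneg hG (Pi.single i 1 + Pi.single j 1)
  have hsub := dotProduct_mulVec_nonneg hG (Pi.single i 1 - Pi.single j 1)
  simp only [mulVec_add, mulVec_sub, add_dotProduct, sub_dotProduct, dotProduct_add,
    dotProduct_sub, mulVec_single_one, single_one_dotProduct, col_apply, hsymm] at hadd hsub
  rw [abs_le]
  constructor <;> linarith [hdiag i, hdiag j]

lemma abs_sub_apply_le_of_mem_Icc [Fintype n] {M N G : Matrix n n ℝ} (hG : G ∈ Set.Icc M N)
    (i j : n) : |G i j - M i j| ≤ (N - M).trace := by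
  refine (abs_apply_le_trace (sub_nonneg.2 hG.1) i j).trans ?_
  have htrace := (Matrix.nonneg_iff_posSemidef.1 (sub_nonneg.2 hG.2)).trace_nonneg
  rw [trace_sub] at htrace ⊢
  rw [trace_sub]
  linarith

instance compactIccSpace_matrix [Finite n] : CompactIccSpace (Matrix n n ℝ) where
  isCompact_Icc {M N} := by
    have := Fintype.ofFinite n
    refine IsCompact.of_isClosed_subset (X := n → n → ℝ)
      (isCompact_univ_pi fun i => isCompact_univ_pi fun j =>
        isCompact_Icc (a := M i j - (N - M).trace) (b := M i j + (N - M).trace))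
      (isClosed_Icc (α := Matrix n n ℝ)) fun G hG i _ j _ => ?_
    obtain ⟨h₁, h₂⟩ := abs_le.1 (abs_sub_apply_le_of_mem_Icc hG i j)
    constructor <;> linarith

lemma inv_integral_smul_integral_smul_mem {α E : Type*} [MeasurableSpace α] {μ : Measure α}
    [NormedAddCommGroup E] [NormedSpace ℝ E] [CompleteSpace E] {K : Set E} (hK : Convex ℝ K)
    (hKc : IsClosed K) {f : α → E} {g : α → ℝ} (hfK : ∀ᵐ x ∂μ, f x ∈ K) (hg0 : 0 ≤ᵐ[μ] g)
    (hg : Integrable g μ) (hgpos : 0 < ∫ x, g x ∂μ) (hfg : Integrable (fun x => g x • f x) μ) :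
    (∫ x, g x ∂μ)⁻¹ • ∫ x, g x • f x ∂μ ∈ K := by
  set ν := μ.withDensity fun x => ENNReal.ofReal (g x)
  have hgm : AEMeasurable (fun x => ENNReal.ofReal (g x)) μ := hg.aemeasurable.ennreal_ofReal
  have hgtop : ∀ᵐ x ∂μ, ENNReal.ofReal (g x) < ⊤ := ae_of_all _ fun _ => ENNReal.ofReal_lt_top
  have htoReal : (fun x => (ENNReal.ofReal (g x)).toReal • f x) =ᵐ[μ] fun x => g x • f x := by
    filter_upwards [hg0] with x hx
    rw [ENNReal.toReal_ofReal hx]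
  have hmass : ν Set.univ = ENNReal.ofReal (∫ x, g x ∂μ) := by
    rw [withDensity_apply _ .univ, Measure.restrict_univ,
      ofReal_integral_eq_lintegral_ofReal hg hg0]
  have : IsFiniteMeasure ν := isFiniteMeasure_withDensity_ofReal hg.2
  have : NeZero ν := ⟨fun h => by simp [h, hgpos.not_ge, eq_comm] at hmass⟩
  have hmem := hK.average_mem hKc ((withDensity_absolutelyContinuous _ _).ae_le hfK)
    ((integrable_withDensity_iff_integrable_smul₀' hgm hgtop).2 (hfg.congr htoReal.symm))
  rwa [average_eq, integral_withDensity_eq_integral_toReal_smul₀ hgm hgtop,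
    integral_congr_ae htoReal, measureReal_def, hmass, ENNReal.toReal_ofReal hgpos.le] at hmem

lemma of_integral_mul_div_integral_mem {α : Type*} [MeasurableSpace α] {μ : Measure α}
    [Finite m] [Finite n] {K : Set (Matrix m n ℝ)} (hK : Convex ℝ K) (hKc : IsClosed K)
    {f : α → Matrix m n ℝ} {g : α → ℝ} (hfK : ∀ᵐ x ∂μ, f x ∈ K) (hg0 : 0 ≤ᵐ[μ] g)
    (hg : Integrable g μ) (hgpos : 0 < ∫ x, g x ∂μ)
    (hfg : ∀ i j, Integrable (fun x => f x i j * g x) μ) :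
    (Matrix.of fun i j => (∫ x, f x i j * g x ∂μ) / ∫ x, g x ∂μ) ∈ K := by
  have := Fintype.ofFinite m
  have := Fintype.ofFinite n
  have hrow (i) : Integrable (fun x j => g x * f x i j) μ :=
    .of_eval fun j => by simpa only [mul_comm] using hfg i j
  have hmean : (∫ x, g x ∂μ)⁻¹ • ∫ x, (fun i j => g x * f x i j) ∂μ =
      fun i j => (∫ x, f x i j * g x ∂μ) / ∫ x, g x ∂μ := by
    ext i j
    rw [Pi.smul_apply, Pi.smul_apply, eval_integral hrow,
      eval_integral fun j => (hrow i).eval j]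
    simp only [smul_eq_mul, div_eq_inv_mul, mul_comm]
  exact hmean ▸ inv_integral_smul_integral_smul_mem (E := m → n → ℝ) hK hKc hfK hg0 hg hgpos
    (.of_eval hrow)

end MatrixTopology

section InverseWishart

variable {d : ℕ}

lemma LoewnerBounded.subset_Icc {𝒮 : Set (Mat d)} {a b : ℝ} (h : LoewnerBounded 𝒮 a b) :
    𝒮 ⊆ Set.Icc (a • 1) (b • 1) := h

instance isFiniteMeasureOnCompacts_symVolume :
    IsFiniteMeasureOnCompacts (symVolume d) where
  lt_top_of_isCompact K hK := by
    have hmeas : Measurable fun u : Sym2 (Fin d) → ℝ => (Matrix.of fun i j => u s(i, j) : Mat d) :=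
      measurable_matrix_of fun i j => measurable_pi_apply _
    have hcont : Continuous fun (G : Mat d) (s : Sym2 (Fin d)) =>
        G (Quot.out s).1 (Quot.out s).2 := by fun_prop
    rw [symVolume, Measure.map_apply hmeas hK.measurableSet]
    refine lt_of_le_of_lt (measure_mono ?_) (hK.image hcont).measure_lt_top
    exact fun u hu => ⟨_, hu, funext fun s => congrArg u (Quot.out_eq s)⟩

lemma multivariateGamma_pos {γ : ℝ} (hγ : (d : ℝ) + 1 < γ) :
    0 < multivariateGamma d (γ / 2) := by
  refine mul_pos (Real.rpow_pos_of_pos Real.pi_pos _) (Finset.prod_pos fun j _ => ?_)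
  have : (j : ℝ) < d := by exact_mod_cast j.2
  exact Real.Gamma_pos_of_pos (by linarith)

lemma invWishart_pos {G Δ : Mat d} (hG : G.PosDef) (hΔ : Δ.PosDef) {γ : ℝ}
    (hγ : (d : ℝ) + 1 < γ) : 0 < invWishart G Δ γ := by
  have hdetΔ := Real.rpow_pos_of_pos hΔ.det_pos (γ / 2)
  have hdetG := Real.rpow_pos_of_pos hG.det_pos (-(γ + d + 1) / 2)
  have hΓ := multivariateGamma_pos hγ
  unfold invWishart
  positivity

lemma measurable_invWishart {X : Type*} [MeasurableSpace X] {G Δ : X → Mat d}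
    (hG : Measurable G) (hΔ : Measurable Δ) (γ : ℝ) :
    Measurable fun x => invWishart (G x) (Δ x) γ := by
  have hdet : Measurable fun G : Mat d => G.det := continuous_id.matrix_det.measurable
  have htrace : Measurable fun x => (Δ x * (G x)⁻¹).trace := by
    simp only [Matrix.trace, Matrix.diag_apply, Matrix.mul_apply]
    exact Finset.measurable_fun_sum _ fun i _ => Finset.measurable_fun_sum _ fun j _ =>
      ((measurable_matrix_elem i j).comp hΔ).mul
        ((measurable_matrix_elem j i).comp (measurable_matrix_inv.comp hG))
  exact ((((hdet.comp hΔ).pow_const _).div_const _).mul ((hdet.comp hG).pow_const _)).mul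
    (Real.measurable_exp.comp (htrace.neg.div_const _))

lemma continuousOn_invWishart (Δ : Mat d) (γ : ℝ) :
    ContinuousOn (fun G => invWishart G Δ γ) {G | G.PosDef} := by
  have hdet : ContinuousOn (fun G : Mat d => G.det ^ (-(γ + d + 1) / 2)) {G | G.PosDef} :=
    continuous_id.matrix_det.continuousOn.rpow_const fun G hG =>
      Or.inl (PosDef.det_pos hG).ne'
  have htrace : ContinuousOn (fun G : Mat d => (Δ * G⁻¹).trace) {G | G.PosDef} :=
    (continuous_const.matrix_mul continuous_id).matrix_trace.comp_continuousOn
      continuousOn_matrix_inv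
  exact (continuousOn_const.mul hdet).mul
    (Real.continuous_exp.comp_continuousOn (htrace.neg.div_const _))

variable {𝒮 K L : Set (Mat d)} {f : Mat d → Mat d}

lemma constrainedMean_mem (hm : MeasurableSet 𝒮) (hvol : 0 < symVolume d 𝒮) (h𝒮 : 𝒮 ⊆ L)
    (hL : IsCompact L) (hLpos : ∀ G ∈ L, G.PosDef) (hK : Convex ℝ K) (hKc : IsClosed K)
    (hf : ContinuousOn f L) (hfK : Set.MapsTo f 𝒮 K) {Δ : Mat d} (hΔ : Δ.PosDef) {γ : ℝ}
    (hγ : (d : ℝ) + 1 < γ) : constrainedMean 𝒮 f Δ γ ∈ K := by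
  have hpos {G} (hG : G ∈ 𝒮) : 0 < invWishart G Δ γ := invWishart_pos (hLpos G (h𝒮 hG)) hΔ hγ
  have hpos_ae : ∀ᵐ G ∂(symVolume d).restrict 𝒮, 0 ≤ invWishart G Δ γ := by
    filter_upwards [ae_restrict_mem hm] with G hG using (hpos hG).le
  have hW : ContinuousOn (fun G => invWishart G Δ γ) L := (continuousOn_invWishart Δ γ).mono hLpos
  have hint {g : Mat d → ℝ} (hg : ContinuousOn g L) : IntegrableOn g 𝒮 (symVolume d) :=
    (hg.integrableOn_compact hL).mono_set h𝒮
  refine of_integral_mul_div_integral_mem hK hKc ((ae_restrict_mem hm).mono hfK) hpos_ae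
    (hint hW) ?_ fun i j => hint (((continuous_id.matrix_elem i j).comp_continuousOn hf).mul hW)
  rw [setIntegral_pos_iff_support_of_nonneg_ae hpos_ae (hint hW)]
  exact hvol.trans_le (measure_mono fun G hG => ⟨(hpos hG).ne', hG⟩)

lemma importanceMean_mem {J : ℕ} (hpd : ∀ G ∈ 𝒮, G.PosDef) {G : Fin J → Mat d}
    {π : Mat d → ℝ} (hπ : ∀ j, G j ∈ 𝒮 → 0 < π (G j)) (hex : ∃ j, G j ∈ 𝒮)
    (hK : Convex ℝ K) (hfK : Set.MapsTo f 𝒮 K) {Δ : Mat d} (hΔ : Δ.PosDef) {γ : ℝ}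
    (hγ : (d : ℝ) + 1 < γ) : importanceMean 𝒮 G π f Δ γ ∈ K := by
  classical
  set c : Fin J → ℝ := fun j => 𝒮.indicator (fun H => invWishart H Δ γ / π H) (G j) with hc
  have hpos (j) (hj : G j ∈ 𝒮) : 0 < c j := by
    simpa only [hc, Set.indicator_of_mem hj] using
      div_pos (invWishart_pos (hpd _ hj) hΔ hγ) (hπ j hj)
  have hnonneg (j) : 0 ≤ c j := by
    by_cases h : G j ∈ 𝒮
    · exact (hpos j h).le
    · exact (Set.indicator_of_notMem h _).ge
  obtain ⟨j₀, hj₀⟩ := hex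
  have hmem := hK.centerMass_mem (t := Finset.univ.filter (c · ≠ 0)) (fun j _ => hnonneg j)
    (Finset.sum_pos' (fun j _ => hnonneg j) ⟨j₀, by simp [(hpos j₀ hj₀).ne'], hpos j₀ hj₀⟩)
    (z := fun j => f (G j)) fun j hj =>
      hfK (Set.mem_of_indicator_ne_zero (Finset.mem_filter.1 hj).2)
  rwa [Finset.centerMass_filter_ne_zero] at hmem

end InverseWishart

section Integrators

variable {d : ℕ} {Ω : Type*}

/-- The outcome `ω` is one for which the integrator is meaningful. -/
def Integrator.Proper (I : Integrator Ω d) (ω : Ω) (𝒮 : Set (Mat d)) : Prop :=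
  match I with
  | .exact => True
  | .sampled _ G π => (∀ j, G j ω ∈ 𝒮 → 0 < π ω (G j ω)) ∧ ∃ j, G j ω ∈ 𝒮

variable {𝒮 : Set (Mat d)} {f : Mat d → Mat d} {I : Integrator Ω d}

lemma Integrator.Admissible.ae_proper [MeasurableSpace Ω] {μ : Measure Ω}
    (hI : I.Admissible μ 𝒮) : ∀ᵐ ω ∂μ, I.Proper ω 𝒮 := by
  cases I with
  | exact => exact ae_of_all _ fun _ => trivial
  | sampled J G π => exact hI.2.2

lemma Integrator.Proper.mean_mem {K L : Set (Mat d)} {ω : Ω} (hI : I.Proper ω 𝒮)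
    (hm : MeasurableSet 𝒮) (hvol : 0 < symVolume d 𝒮) (h𝒮 : 𝒮 ⊆ L) (hL : IsCompact L)
    (hLpos : ∀ G ∈ L, G.PosDef) (hK : Convex ℝ K) (hKc : IsClosed K) (hf : ContinuousOn f L)
    (hfK : Set.MapsTo f 𝒮 K) {Δ : Mat d} (hΔ : Δ.PosDef) {γ : ℝ} (hγ : (d : ℝ) + 1 < γ) :
    I.mean ω 𝒮 f Δ γ ∈ K := by
  cases I with
  | exact => exact constrainedMean_mem hm hvol h𝒮 hL hLpos hK hKc hf hfK hΔ hγ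
  | sampled J G π =>
    exact importanceMean_mem (fun G hG => hLpos G (h𝒮 hG)) hI.1 hI.2 hK hfK hΔ hγ

section Loewner

variable {a b : ℝ} {ω : Ω}

lemma Integrator.Proper.mean_id_mem_Icc (hI : I.Proper ω 𝒮) (hm : MeasurableSet 𝒮)
    (hvol : 0 < symVolume d 𝒮) (hbd : LoewnerBounded 𝒮 a b) (ha : 0 < a) {Δ : Mat d}
    (hΔ : Δ.PosDef) {γ : ℝ} (hγ : (d : ℝ) + 1 < γ) :
    I.mean ω 𝒮 (fun G => G) Δ γ ∈ Set.Icc (a • 1) (b • 1) :=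
  hI.mean_mem hm hvol hbd.subset_Icc isCompact_Icc (fun _ hG => posDef_of_smul_one_le ha hG.1)
    (convex_Icc _ _) isClosed_Icc continuousOn_id (fun _ hG => hbd.subset_Icc hG) hΔ hγ

lemma Integrator.Proper.mean_inv_mem_Icc (hI : I.Proper ω 𝒮) (hm : MeasurableSet 𝒮)
    (hvol : 0 < symVolume d 𝒮) (hbd : LoewnerBounded 𝒮 a b) (ha : 0 < a) (hb : 0 < b)
    {Δ : Mat d} (hΔ : Δ.PosDef) {γ : ℝ} (hγ : (d : ℝ) + 1 < γ) :
    I.mean ω 𝒮 (fun G => G⁻¹) Δ γ ∈ Set.Icc (b⁻¹ • 1) (a⁻¹ • 1) :=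
  have hpos (G) (hG : G ∈ Set.Icc (a • (1 : Mat d)) (b • 1)) : G.PosDef :=
    posDef_of_smul_one_le ha hG.1
  hI.mean_mem hm hvol hbd.subset_Icc isCompact_Icc hpos (convex_Icc _ _) isClosed_Icc
    (continuousOn_matrix_inv.mono hpos) (fun _ hG => inv_mem_Icc ha hb (hbd.subset_Icc hG)) hΔ hγ

end Loewner

lemma measurable_constrainedMean (𝒮 : Set (Mat d)) (hf : Measurable f) (γ : ℝ) :
    Measurable fun Δ => constrainedMean 𝒮 f Δ γ := by
  have : SFinite (symVolume d) := by unfold symVolume; infer_instance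
  have hW : Measurable fun p : Mat d × Mat d => invWishart p.2 p.1 γ :=
    measurable_invWishart measurable_snd measurable_fst γ
  refine measurable_matrix_of fun i j => Measurable.div ?_ ?_
  · exact (((measurable_matrix_elem i j).comp (hf.comp measurable_snd)).mul
      hW).stronglyMeasurable.integral_prod_right'.measurable
  · exact hW.stronglyMeasurable.integral_prod_right'.measurable

lemma Integrator.Admissible.measurable_mean [MeasurableSpace Ω] {μ : Measure Ω}
    (hI : I.Admissible μ 𝒮) (hm : MeasurableSet 𝒮) (hf : Measurable f) (γ : ℝ) :
    Measurable fun p : Ω × Mat d => I.mean p.1 𝒮 f p.2 γ := by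
  cases I with
  | exact => exact (measurable_constrainedMean 𝒮 hf γ).comp measurable_snd
  | sampled J G π =>
    obtain ⟨hG, hπ, -⟩ := hI
    have hG' (j) : Measurable fun p : Ω × Mat d => G j p.1 := (hG j).comp measurable_fst
    have hweight (j) : Measurable fun p : Ω × Mat d =>
        𝒮.indicator (fun H => invWishart H p.2 γ / π p.1 H) (G j p.1) := by
      have hratio : Measurable fun p : Ω × Mat d =>
          invWishart (G j p.1) p.2 γ / π p.1 (G j p.1) :=
        (measurable_invWishart (hG' j) measurable_snd γ).div
          (hπ.comp (measurable_fst.prodMk (hG' j)))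
      exact hratio.indicator ((hG' j) hm)
    refine measurable_matrix_of fun i k => ?_
    simp only [Integrator.mean, importanceMean, Matrix.smul_apply, Matrix.sum_apply, smul_eq_mul]
    exact (Finset.measurable_fun_sum _ fun j _ => hweight j).inv.mul
      (Finset.measurable_fun_sum _ fun j _ => (hweight j).mul
        ((measurable_matrix_elem i k).comp (hf.comp (hG' j))))

end Integrators

section AEMeasurability

variable {Ω : Type*} [MeasurableSpace Ω] {μ : Measure Ω}

section Matrices

variable {l m n : Type*}

instance secondCountableTopology_matrix [Countable m] [Countable n] :
    SecondCountableTopology (Matrix m n ℝ) :=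
  inferInstanceAs (SecondCountableTopology (m → n → ℝ))

lemma aemeasurable_matrix [Countable m] [Countable n] {f : Ω → Matrix m n ℝ}
    (h : ∀ i j, AEMeasurable (fun ω => f ω i j) μ) : AEMeasurable f μ :=
  aemeasurable_pi_iff.2 fun i => aemeasurable_pi_iff.2 fun j => h i j

lemma aemeasurable_matrix_elem {f : Ω → Matrix m n ℝ} (hf : AEMeasurable f μ) (i : m) (j : n) :
    AEMeasurable (fun ω => f ω i j) μ :=
  (measurable_matrix_elem i j).comp_aemeasurable hf

@[fun_prop]
lemma aemeasurable_matrix_mul [Countable l] [Fintype m] [Countable n] {f : Ω → Matrix l m ℝ}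
    {g : Ω → Matrix m n ℝ} (hf : AEMeasurable f μ) (hg : AEMeasurable g μ) :
    AEMeasurable (fun ω => f ω * g ω) μ :=
  aemeasurable_matrix fun i j => by
    simp only [Matrix.mul_apply]
    fun_prop

lemma aemeasurable_dotProduct [Fintype m] {f g : Ω → m → ℝ} (hf : AEMeasurable f μ)
    (hg : AEMeasurable g μ) : AEMeasurable (fun ω => f ω ⬝ᵥ g ω) μ := by
  simp only [dotProduct]
  fun_prop

@[fun_prop]
lemma aemeasurable_mulVec [Countable l] [Fintype m] {f : Ω → Matrix l m ℝ}
    {g : Ω → m → ℝ} (hf : AEMeasurable f μ) (hg : AEMeasurable g μ) :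
    AEMeasurable (fun ω => f ω *ᵥ g ω) μ :=
  aemeasurable_pi_iff.2 fun i => aemeasurable_dotProduct (aemeasurable_pi_iff.1 hf i) hg

@[fun_prop]
lemma aemeasurable_matrix_inv [Fintype n] [DecidableEq n] {f : Ω → Matrix n n ℝ}
    (hf : AEMeasurable f μ) : AEMeasurable (fun ω => (f ω)⁻¹) μ :=
  measurable_matrix_inv.comp_aemeasurable hf

@[fun_prop]
lemma aemeasurable_matBlock {T d : ℕ} {f : Ω → WinMat T d} (hf : AEMeasurable f μ)
    (a b : Fin (T + 1)) : AEMeasurable (fun ω => (f ω).block a b) μ :=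
  aemeasurable_matrix fun i j => aemeasurable_matrix_elem hf (a, i) (b, j)

@[fun_prop]
lemma aemeasurable_vecBlock {T d : ℕ} {f : Ω → WinVec T d} (hf : AEMeasurable f μ)
    (a : Fin (T + 1)) : AEMeasurable (fun ω => (f ω).block a) μ :=
  aemeasurable_pi_iff.2 fun i => aemeasurable_pi_iff.1 hf (a, i)

end Matrices

/-- A random state whose matrix and vector components are almost everywhere measurable and whose
degrees of freedom are deterministic, as they are along the filter. -/
structure State.AEMeas {nx ny : ℕ} (μ : Measure Ω) (st : Ω → State nx ny) : Prop where
  x : AEMeasurable (fun ω => (st ω).x) μ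
  P : AEMeasurable (fun ω => (st ω).P) μ
  M : AEMeasurable (fun ω => (st ω).M) μ
  S : AEMeasurable (fun ω => (st ω).S) μ
  Φ : AEMeasurable (fun ω => (st ω).Φ) μ
  Ψ : AEMeasurable (fun ω => (st ω).Ψ) μ
  m : ∃ r, ∀ ω, (st ω).m = r
  s : ∃ r, ∀ ω, (st ω).s = r

lemma Integrator.Admissible.aemeasurable_mean {d : ℕ} {𝒮 : Set (Mat d)}
    {I : Integrator Ω d} (hI : I.Admissible μ 𝒮) (hm : MeasurableSet 𝒮) {f : Mat d → Mat d}
    (hf : Measurable f) {Δ : Ω → Mat d} (hΔ : AEMeasurable Δ μ) {γ : Ω → ℝ} {r : ℝ}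
    (hγ : ∀ ω, γ ω = r) :
    AEMeasurable (fun ω => I.mean ω 𝒮 f (Δ ω) (γ ω)) μ := by
  obtain rfl : γ = fun _ => r := funext hγ
  have hprod : AEMeasurable (fun ω => (ω, Δ ω)) μ := aemeasurable_id'.prodMk hΔ
  simpa only [Function.comp_def] using (hI.measurable_mean hm hf r).comp_aemeasurable hprod

namespace VBFilter

variable {nx ny : ℕ} (F : VBFilter Ω nx ny) {st : Ω → State nx ny}
  {P Φ : Ω → Mat nx} {Ψ : Ω → Mat ny} {y : ℕ → Ω → Vec ny}

lemma aemeasurable_precisionBlock (hP : AEMeasurable P μ) (hΦ : AEMeasurable Φ μ)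
    (hΨ : AEMeasurable Ψ μ) (a b : Fin (F.T + 1)) :
    AEMeasurable (fun ω => F.precisionBlock (P ω) (Φ ω) (Ψ ω) a b) μ := by
  unfold precisionBlock
  split_ifs <;> fun_prop

lemma aemeasurable_winCov (hst : State.AEMeas μ st) (hΦ : AEMeasurable Φ μ)
    (hΨ : AEMeasurable Ψ μ) : AEMeasurable (fun ω => F.winCov (st ω) (Φ ω) (Ψ ω)) μ :=
  aemeasurable_matrix_inv <| aemeasurable_matrix fun p q =>
    aemeasurable_matrix_elem (F.aemeasurable_precisionBlock hst.P hΦ hΨ p.1 q.1) p.2 q.2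

lemma aemeasurable_infoVec (hst : State.AEMeas μ st) (hΨ : AEMeasurable Ψ μ)
    (hy : ∀ t, 1 ≤ t → AEMeasurable (y t) μ) (t : ℕ) :
    AEMeasurable (fun ω => F.infoVec (fun k => y k ω) t (st ω) (Ψ ω)) μ := by
  refine aemeasurable_pi_iff.2 fun p => ?_
  unfold infoVec
  split_ifs with hp
  · exact aemeasurable_pi_iff.1 (aemeasurable_mulVec (aemeasurable_matrix_inv hst.P) hst.x) p.2
  · have := hy (t - F.T + p.1) (by omega)
    fun_prop

lemma aemeasurable_winMean (hst : State.AEMeas μ st) (hΦ : AEMeasurable Φ μ)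
    (hΨ : AEMeasurable Ψ μ) (hy : ∀ t, 1 ≤ t → AEMeasurable (y t) μ) (t : ℕ) :
    AEMeasurable (fun ω => F.winMean (fun k => y k ω) t (st ω) (Φ ω) (Ψ ω)) μ :=
  aemeasurable_mulVec (F.aemeasurable_winCov hst hΦ hΨ) (F.aemeasurable_infoVec hst hΨ hy t)

lemma aemeasurable_scaleM (hst : State.AEMeas μ st) {x : Ω → WinVec F.T nx}
    {P : Ω → WinMat F.T nx} (hx : AEMeasurable x μ) (hP : AEMeasurable P μ) :
    AEMeasurable (fun ω => F.scaleM (st ω) (x ω) (P ω)) μ :=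
  hst.M.add (by fun_prop)

lemma aemeasurable_scaleS (hst : State.AEMeas μ st) (hy : ∀ t, 1 ≤ t → AEMeasurable (y t) μ)
    (t : ℕ) {x : Ω → WinVec F.T nx} {P : Ω → WinMat F.T nx} (hx : AEMeasurable x μ)
    (hP : AEMeasurable P μ) :
    AEMeasurable (fun ω => F.scaleS (fun k => y k ω) t (st ω) (x ω) (P ω)) μ :=
  hst.S.add <| Finset.aemeasurable_fun_sum _ fun i _ => by
    have := hy (t - F.T + (i + 1)) (by omega)
    fun_prop

lemma aemeasurable_iterM (hst : State.AEMeas μ st) (hΦ : AEMeasurable Φ μ)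
    (hΨ : AEMeasurable Ψ μ) (hy : ∀ t, 1 ≤ t → AEMeasurable (y t) μ) (t : ℕ) :
    AEMeasurable (fun ω => F.iterM (fun k => y k ω) t (st ω) (Φ ω) (Ψ ω)) μ :=
  F.aemeasurable_scaleM hst (F.aemeasurable_winMean hst hΦ hΨ hy t)
    (F.aemeasurable_winCov hst hΦ hΨ)

lemma aemeasurable_iterS (hst : State.AEMeas μ st) (hΦ : AEMeasurable Φ μ)
    (hΨ : AEMeasurable Ψ μ) (hy : ∀ t, 1 ≤ t → AEMeasurable (y t) μ) (t : ℕ) :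
    AEMeasurable (fun ω => F.iterS (fun k => y k ω) t (st ω) (Φ ω) (Ψ ω)) μ :=
  F.aemeasurable_scaleS hst hy t (F.aemeasurable_winMean hst hΦ hΨ hy t)
    (F.aemeasurable_winCov hst hΦ hΨ)

variable {F}

lemma Admissible.aemeasurable_variational (hF : F.Admissible μ) (hst : State.AEMeas μ st)
    (hy : ∀ t, 1 ≤ t → AEMeasurable (y t) μ) {t : ℕ} (ht : F.T ≤ t) (k : ℕ) (hk : k ≤ F.N) :
    AEMeasurable (fun ω => (F.variational ω (fun k => y k ω) t (st ω) k).1) μ ∧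
      AEMeasurable (fun ω => (F.variational ω (fun k => y k ω) t (st ω) k).2) μ := by
  induction k with
  | zero => exact ⟨hst.Φ, hst.Ψ⟩
  | succ k ih =>
    obtain ⟨hΦ, hΨ⟩ := ih (by omega)
    obtain ⟨m, hm⟩ := hst.m
    obtain ⟨s, hs⟩ := hst.s
    exact ⟨(hF.adm_Φ t (k + 1) ht (by omega) hk).aemeasurable_mean hF.meas_𝒬 measurable_matrix_inv
        (F.aemeasurable_iterM hst hΦ hΨ hy t) fun ω => congrArg (· + (F.T : ℝ)) (hm ω),
      (hF.adm_Ψ t (k + 1) ht (by omega) hk).aemeasurable_mean hF.meas_ℛ measurable_matrix_inv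
        (F.aemeasurable_iterS hst hΦ hΨ hy t) fun ω => congrArg (· + (F.T : ℝ)) (hs ω)⟩

lemma Admissible.aemeas_update (hF : F.Admissible μ) (hst : State.AEMeas μ st)
    (hy : ∀ t, 1 ≤ t → AEMeasurable (y t) μ) {t : ℕ} (ht : F.T ≤ t) :
    State.AEMeas μ fun ω => F.update ω (fun k => y k ω) t (st ω) := by
  obtain ⟨hΦ, hΨ⟩ := hF.aemeasurable_variational hst hy ht (F.N - 1) (by omega)
  obtain ⟨hΦ', hΨ'⟩ := hF.aemeasurable_variational hst hy ht F.N le_rfl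
  have hM := F.aemeasurable_iterM hst hΦ hΨ hy t
  have hS := F.aemeasurable_iterS hst hΦ hΨ hy t
  obtain ⟨m, hm⟩ := hst.m
  obtain ⟨s, hs⟩ := hst.s
  have hQ : AEMeasurable (fun ω => F.Qhat ω (fun k => y k ω) t (st ω)) μ :=
    (hF.adm_Q t ht).aemeasurable_mean hF.meas_𝒬 measurable_id hM
      fun ω => congrArg (· + (F.T : ℝ)) (hm ω)
  have hR : AEMeasurable (fun ω => F.Rhat ω (fun k => y k ω) t (st ω)) μ :=
    (hF.adm_R t ht).aemeasurable_mean hF.meas_ℛ measurable_id hS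
      fun ω => congrArg (· + (F.T : ℝ)) (hs ω)
  have hpred : AEMeasurable (fun ω => F.predCov ω (fun k => y k ω) t (st ω)) μ :=
    (aemeasurable_matrix_mul (aemeasurable_matrix_mul aemeasurable_const hst.P)
      aemeasurable_const).add hQ
  have hgain : AEMeasurable (fun ω => F.gain ω (fun k => y k ω) t (st ω)) μ := by
    unfold gain
    fun_prop
  have hx : AEMeasurable (fun ω => F.A *ᵥ (st ω).x) μ :=
    aemeasurable_mulVec aemeasurable_const hst.x
  have hy₁ := hy (t - F.T + 1) (by omega)
  exact
    { x := hx.add (aemeasurable_mulVec hgain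
        (hy₁.sub (aemeasurable_mulVec aemeasurable_const hx)))
      P := aemeasurable_matrix_mul
        (aemeasurable_const.sub (aemeasurable_matrix_mul hgain aemeasurable_const)) hpred
      M := hM.const_smul F.ρ
      S := hS.const_smul F.ρ
      Φ := hΦ'
      Ψ := hΨ'
      m := ⟨F.ρ * (m + F.T - nx - 1) + nx + 1, fun ω => by simp only [update, hm]⟩
      s := ⟨F.ρ * (s + F.T - ny - 1) + ny + 1, fun ω => by simp only [update, hs]⟩ }

lemma Admissible.aemeas_state (hF : F.Admissible μ)
    (hy : ∀ t, 1 ≤ t → AEMeasurable (y t) μ) (n : ℕ) :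
    State.AEMeas μ fun ω => F.state ω (fun k => y k ω) n := by
  induction n with
  | zero =>
    exact
      { x := aemeasurable_const
        P := aemeasurable_const
        M := aemeasurable_const
        S := aemeasurable_const
        Φ := hF.adm_Φ₀.aemeasurable_mean hF.meas_𝒬 measurable_matrix_inv aemeasurable_const
          fun _ => rfl
        Ψ := hF.adm_Ψ₀.aemeasurable_mean hF.meas_ℛ measurable_matrix_inv aemeasurable_const
          fun _ => rfl
        m := ⟨_, fun _ => rfl⟩
        s := ⟨_, fun _ => rfl⟩ }
  | succ n ih => exact hF.aemeas_update ih hy (Nat.le_add_right _ _)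

lemma Admissible.aemeasurable_estimate (hF : F.Admissible μ)
    (hy : ∀ t, 1 ≤ t → AEMeasurable (y t) μ) {t : ℕ} (ht : F.T ≤ t) :
    AEMeasurable (fun ω => F.estimate ω (fun k => y k ω) t) μ := by
  have hst := hF.aemeas_state hy (t - F.T)
  obtain ⟨hΦ, hΨ⟩ := hF.aemeasurable_variational hst hy ht (F.N - 1) (by omega)
  exact aemeasurable_vecBlock (F.aemeasurable_winMean hst hΦ hΨ hy t) _

end VBFilter

end AEMeasurability

namespace VBFilter

section Regularity

variable {Ω : Type*} {nx ny : ℕ}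

/-- All integrators that the filter uses are meaningful at the outcome `ω`. -/
structure ProperAt (F : VBFilter Ω nx ny) (ω : Ω) : Prop where
  Φ₀ : F.intΦ₀.Proper ω F.𝒬
  Ψ₀ : F.intΨ₀.Proper ω F.ℛ
  Φ : ∀ t k, F.T ≤ t → 1 ≤ k → k ≤ F.N → (F.intΦ t k).Proper ω F.𝒬
  Ψ : ∀ t k, F.T ≤ t → 1 ≤ k → k ≤ F.N → (F.intΨ t k).Proper ω F.ℛ
  Q : ∀ t, F.T ≤ t → (F.intQ t).Proper ω F.𝒬
  R : ∀ t, F.T ≤ t → (F.intR t).Proper ω F.ℛ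

lemma Admissible.ae_properAt {F : VBFilter Ω nx ny} [MeasurableSpace Ω] {μ : Measure Ω}
    (hF : F.Admissible μ) : ∀ᵐ ω ∂μ, F.ProperAt ω := by
  have hΦ : ∀ᵐ ω ∂μ, ∀ t k, F.T ≤ t → 1 ≤ k → k ≤ F.N → (F.intΦ t k).Proper ω F.𝒬 := by
    simp only [ae_all_iff]
    exact fun t k ht hk hN => (hF.adm_Φ t k ht hk hN).ae_proper
  have hΨ : ∀ᵐ ω ∂μ, ∀ t k, F.T ≤ t → 1 ≤ k → k ≤ F.N → (F.intΨ t k).Proper ω F.ℛ := by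
    simp only [ae_all_iff]
    exact fun t k ht hk hN => (hF.adm_Ψ t k ht hk hN).ae_proper
  have hQ : ∀ᵐ ω ∂μ, ∀ t, F.T ≤ t → (F.intQ t).Proper ω F.𝒬 := by
    simp only [ae_all_iff]
    exact fun t ht => (hF.adm_Q t ht).ae_proper
  have hR : ∀ᵐ ω ∂μ, ∀ t, F.T ≤ t → (F.intR t).Proper ω F.ℛ := by
    simp only [ae_all_iff]
    exact fun t ht => (hF.adm_R t ht).ae_proper
  filter_upwards [hF.adm_Φ₀.ae_proper, hF.adm_Ψ₀.ae_proper, hΦ, hΨ, hQ, hR]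
    with ω hΦ₀ hΨ₀ hΦ hΨ hQ hR
  exact ⟨hΦ₀, hΨ₀, hΦ, hΨ, hQ, hR⟩

/-- The constants of the stability analysis of `F`: Loewner bounds on `𝒬` and `ℛ`, a matrix `Θ`
such that `A P Aᵀ + b I ≤ Θ` is an invariant of the Riccati recursion for the covariances `P` of the
filter, and the resulting bound `p` on these covariances. -/
structure StabilityBounds (F : VBFilter Ω nx ny) where
  (a b β β' p : ℝ)
  Θ : Mat nx
  a_pos : 0 < a
  b_pos : 0 < b
  β_pos : 0 < β
  β'_pos : 0 < β'
  p_pos : 0 < p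
  loewnerBounded_𝒬 : LoewnerBounded F.𝒬 a b
  loewnerBounded_ℛ : LoewnerBounded F.ℛ β β'
  Θ_le : Θ ≤ p • 1
  P₀_le : F.P₀ ≤ p • 1
  init_le : F.A * F.P₀ * F.Aᵀ + b • 1 ≤ Θ
  step_le : ∀ P Q R, P.PosDef → Q ∈ Set.Icc (a • 1) (b • 1) → R ∈ Set.Icc (β • 1) (β' • 1) →
    F.A * P * F.Aᵀ + b • 1 ≤ Θ → F.A * riccatiStep F.A F.C Q R P * F.Aᵀ + b • 1 ≤ Θ

lemma nonempty_stabilityBounds {F : VBFilter Ω nx ny} (hP₀ : F.P₀.PosSemidef)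
    (hAC : Detectable F.A F.C) (h𝒬 : ∃ a b : ℝ, 0 < a ∧ a ≤ b ∧ LoewnerBounded F.𝒬 a b)
    (hℛ : ∃ a b : ℝ, 0 < a ∧ a ≤ b ∧ LoewnerBounded F.ℛ a b) : Nonempty F.StabilityBounds := by
  obtain ⟨a, b, ha, hab, h𝒬⟩ := h𝒬
  obtain ⟨β, β', hβ, hββ', hℛ⟩ := hℛ
  have hb := ha.trans_le hab
  have hβ' := hβ.trans_le hββ'
  have hP₀' := nonneg_iff_posSemidef.2 hP₀
  obtain ⟨Θ, hinit, hstep⟩ := exists_riccati_invariant_bound hAC hb.le hβ'.le hP₀'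
  have hΘ : 0 ≤ Θ := (add_nonneg (mul_mul_transpose_nonneg hP₀' F.A)
    (smul_nonneg hb.le (zero_le_one (α := Mat nx)))).trans hinit
  have htrΘ := (nonneg_iff_posSemidef.1 hΘ).trace_nonneg
  have htrP₀ := hP₀.trace_nonneg
  exact ⟨{
    a, b, β, β', Θ, p := Θ.trace + F.P₀.trace + 1
    a_pos := ha, b_pos := hb, β_pos := hβ, β'_pos := hβ', p_pos := by positivity
    loewnerBounded_𝒬 := h𝒬, loewnerBounded_ℛ := hℛ
    Θ_le := (le_trace_smul_one hΘ).trans (by gcongr; linarith)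
    P₀_le := (le_trace_smul_one hP₀').trans (by gcongr; linarith)
    init_le := hinit
    step_le := fun P Q R hP hQ hR => hstep P Q R hP (posDef_of_smul_one_le ha hQ.1)
      (posDef_of_smul_one_le hβ hR.1) hQ.2 hR.2 }⟩

/-- The bounds on the state of the filter that its recursion preserves. -/
structure StabilityBounds.RegularState {F : VBFilter Ω nx ny} (B : F.StabilityBounds)
    (st : State nx ny) : Prop where
  P : st.P.PosDef
  P_le : st.P ≤ B.p • 1
  pred_le : F.A * st.P * F.Aᵀ + B.b • 1 ≤ B.Θ
  M : st.M.PosDef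
  S : st.S.PosDef
  m : (nx : ℝ) + 1 < st.m
  s : (ny : ℝ) + 1 < st.s
  Φ : st.Φ ∈ Set.Icc (B.b⁻¹ • 1) (B.a⁻¹ • 1)
  Ψ : st.Ψ ∈ Set.Icc (B.β'⁻¹ • 1) (B.β⁻¹ • 1)

namespace StabilityBounds

variable {F : VBFilter Ω nx ny} (B : F.StabilityBounds)

lemma posDef_Φ {Φ : Mat nx} (h : Φ ∈ Set.Icc (B.b⁻¹ • 1) (B.a⁻¹ • 1)) : Φ.PosDef :=
  posDef_of_smul_one_le (inv_pos.2 B.b_pos) h.1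

lemma posDef_Ψ {Ψ : Mat ny} (h : Ψ ∈ Set.Icc (B.β'⁻¹ • 1) (B.β⁻¹ • 1)) : Ψ.PosDef :=
  posDef_of_smul_one_le (inv_pos.2 B.β'_pos) h.1

variable [MeasurableSpace Ω] {μ : Measure Ω} {ω : Ω} {st : State nx ny} (y : ℕ → Vec ny) {t : ℕ}

lemma variational_mem_Icc (hF : F.Admissible μ) (hω : F.ProperAt ω) (hst : B.RegularState st)
    (ht : F.T ≤ t) (k : ℕ) (hk : k ≤ F.N) :
    (F.variational ω y t st k).1 ∈ Set.Icc (B.b⁻¹ • 1) (B.a⁻¹ • 1) ∧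
      (F.variational ω y t st k).2 ∈ Set.Icc (B.β'⁻¹ • 1) (B.β⁻¹ • 1) := by
  induction k with
  | zero => exact ⟨hst.Φ, hst.Ψ⟩
  | succ k ih =>
    obtain ⟨hΦ, hΨ⟩ := ih (by omega)
    have hcov := (F.winCov_posDef hst.P (B.posDef_Φ hΦ) (B.posDef_Ψ hΨ)).posSemidef
    exact ⟨(hω.Φ t (k + 1) ht (by omega) hk).mean_inv_mem_Icc hF.meas_𝒬 hF.vol_𝒬
        B.loewnerBounded_𝒬 B.a_pos B.b_pos (F.scaleM_posDef hst.M _ hcov)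
        (lt_add_of_lt_of_nonneg hst.m (Nat.cast_nonneg _)),
      (hω.Ψ t (k + 1) ht (by omega) hk).mean_inv_mem_Icc hF.meas_ℛ hF.vol_ℛ
        B.loewnerBounded_ℛ B.β_pos B.β'_pos (F.scaleS_posDef y t hst.S _ hcov)
        (lt_add_of_lt_of_nonneg hst.s (Nat.cast_nonneg _))⟩

lemma final_posDef (hF : F.Admissible μ) (hω : F.ProperAt ω) (hst : B.RegularState st)
    (ht : F.T ≤ t) : (F.finalM ω y t st).PosDef ∧ (F.finalS ω y t st).PosDef := by
  obtain ⟨hΦ, hΨ⟩ := B.variational_mem_Icc y hF hω hst ht (F.N - 1) (by omega)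
  have hcov := (F.winCov_posDef hst.P (B.posDef_Φ hΦ) (B.posDef_Ψ hΨ)).posSemidef
  exact ⟨F.scaleM_posDef hst.M _ hcov, F.scaleS_posDef y t hst.S _ hcov⟩

lemma Qhat_mem_Icc (hF : F.Admissible μ) (hω : F.ProperAt ω) (hst : B.RegularState st)
    (ht : F.T ≤ t) : F.Qhat ω y t st ∈ Set.Icc (B.a • 1) (B.b • 1) :=
  (hω.Q t ht).mean_id_mem_Icc hF.meas_𝒬 hF.vol_𝒬 B.loewnerBounded_𝒬 B.a_pos
    (B.final_posDef y hF hω hst ht).1 (lt_add_of_lt_of_nonneg hst.m (Nat.cast_nonneg _))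

lemma Rhat_mem_Icc (hF : F.Admissible μ) (hω : F.ProperAt ω) (hst : B.RegularState st)
    (ht : F.T ≤ t) : F.Rhat ω y t st ∈ Set.Icc (B.β • 1) (B.β' • 1) :=
  (hω.R t ht).mean_id_mem_Icc hF.meas_ℛ hF.vol_ℛ B.loewnerBounded_ℛ B.β_pos
    (B.final_posDef y hF hω hst ht).2 (lt_add_of_lt_of_nonneg hst.s (Nat.cast_nonneg _))

lemma regularState_update (hF : F.Admissible μ) (hω : F.ProperAt ω) (hst : B.RegularState st)
    (ht : F.T ≤ t) : B.RegularState (F.update ω y t st) := by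
  obtain ⟨hM, hS⟩ := B.final_posDef y hF hω hst ht
  obtain ⟨hΦ, hΨ⟩ := B.variational_mem_Icc y hF hω hst ht F.N le_rfl
  have hQ := B.Qhat_mem_Icc y hF hω hst ht
  have hR := B.Rhat_mem_Icc y hF hω hst ht
  have hQpos := posDef_of_smul_one_le B.a_pos hQ.1
  have hRpos := posDef_of_smul_one_le B.β_pos hR.1
  exact
    { P := riccatiStep_posDef F.A F.C hst.P hQpos hRpos
      P_le := (riccatiStep_le F.A F.C hst.P hQpos hRpos).trans <|
        (add_le_add_right hQ.2 _).trans (hst.pred_le.trans B.Θ_le)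
      pred_le := B.step_le _ _ _ hst.P hQ hR hst.pred_le
      M := hM.smul hF.ρ_pos
      S := hS.smul hF.ρ_pos
      m := by
        have := mul_pos hF.ρ_pos
          (show 0 < st.m + F.T - nx - 1 by linarith [hst.m, F.T.cast_nonneg (α := ℝ)])
        simp only [update]
        linarith
      s := by
        have := mul_pos hF.ρ_pos
          (show 0 < st.s + F.T - ny - 1 by linarith [hst.s, F.T.cast_nonneg (α := ℝ)])
        simp only [update]
        linarith
      Φ := hΦ
      Ψ := hΨ }

lemma regularState_state (hF : F.Admissible μ) (hω : F.ProperAt ω) (n : ℕ) :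
    B.RegularState (F.state ω y n) := by
  induction n with
  | zero =>
    exact
      { P := hF.posDef_P₀
        P_le := B.P₀_le
        pred_le := B.init_le
        M := hF.posDef_M₀
        S := hF.posDef_S₀
        m := hF.lt_m₀
        s := hF.lt_s₀
        Φ := hω.Φ₀.mean_inv_mem_Icc hF.meas_𝒬 hF.vol_𝒬 B.loewnerBounded_𝒬 B.a_pos B.b_pos
          hF.posDef_M₀ hF.lt_m₀
        Ψ := hω.Ψ₀.mean_inv_mem_Icc hF.meas_ℛ hF.vol_ℛ B.loewnerBounded_ℛ B.β_pos B.β'_pos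
          hF.posDef_S₀ hF.lt_s₀ }
  | succ n ih => exact B.regularState_update y hF hω ih (Nat.le_add_right _ _)

end StabilityBounds

end Regularity

section ErrorEnergy

variable {Ω : Type*} {nx ny : ℕ} {F : VBFilter Ω nx ny}

lemma sub_update_x {ω : Ω} {y : ℕ → Vec ny} {t : ℕ} (st : State nx ny) {x w : Vec nx} {v : Vec ny}
    (hy : y (t - F.T + 1) = F.C *ᵥ (F.A *ᵥ x + w) + v) :
    F.A *ᵥ x + w - (F.update ω y t st).x =
      (1 - F.gain ω y t st * F.C) *ᵥ (F.A *ᵥ (x - st.x) + w) - F.gain ω y t st *ᵥ v := by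
  simp only [update, hy, sub_mulVec, one_mulVec, ← mulVec_mulVec, mulVec_add, mulVec_sub]
  abel

namespace StabilityBounds

variable (B : F.StabilityBounds)

/-- The factor by which one step of the filter contracts the error energy. -/
def rate : ℝ := (1 + B.a / (2 * B.p))⁻¹

lemma rate_nonneg : 0 ≤ B.rate := by
  have := B.a_pos
  have := B.p_pos
  unfold rate
  positivity

lemma rate_lt_one : B.rate < 1 :=
  inv_lt_one_of_one_lt₀ (lt_add_of_pos_right 1 (div_pos B.a_pos (mul_pos two_pos B.p_pos)))

/-- The error energy that the noises `w`, `v` of one step can at most add. Half of `Q̂ ≥ a I` pays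
for the contraction, so that only `a / 2` is left for `w`. -/
def noiseEnergy (w : Vec nx) (v : Vec ny) : ℝ :=
  (B.a / 2)⁻¹ * (w ⬝ᵥ w) + B.β⁻¹ * (v ⬝ᵥ v)

variable [MeasurableSpace Ω] {μ : Measure Ω} {ω : Ω} {st : State nx ny} {y : ℕ → Vec ny} {t : ℕ}

lemma energy_update_le (hF : F.Admissible μ) (hω : F.ProperAt ω) (hst : B.RegularState st)
    (ht : F.T ≤ t) {x x' w : Vec nx} {v : Vec ny} (hx : x' = F.A *ᵥ x + w)
    (hy : y (t - F.T + 1) = F.C *ᵥ x' + v) :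
    (F.update ω y t st).energy x' ≤ B.rate * st.energy x + B.noiseEnergy w v := by
  have ha := B.a_pos
  have hp := B.p_pos
  have hQ := B.Qhat_mem_Icc y hF hω hst ht
  have hpred : F.A * st.P * F.Aᵀ ≤ B.p • 1 :=
    (le_add_of_nonneg_right (smul_nonneg B.b_pos.le (zero_le_one (α := Mat nx)))).trans
      (hst.pred_le.trans B.Θ_le)
  have hδ : (B.a / (2 * B.p)) • (F.A * st.P * F.Aᵀ) + (B.a / 2) • 1 ≤ F.Qhat ω y t st := calc
    _ ≤ (B.a / (2 * B.p)) • B.p • (1 : Mat nx) + (B.a / 2) • 1 := by gcongr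
    _ = B.a • 1 := by
      rw [smul_smul, ← add_smul]
      congr 1
      field_simp
      norm_num
    _ ≤ F.Qhat ω y t st := hQ.1
  subst hx
  exact riccatiStep_energy_le F.A F.C hst.P (posDef_of_smul_one_le ha hQ.1) (half_pos ha) B.β_pos
    (B.Rhat_mem_Icc y hF hω hst ht).1 (by positivity) hδ (sub_update_x st hy)

lemma exists_sq_estimate_error_le (hF : F.Admissible μ) :
    ∃ κ : ℝ, 0 ≤ κ ∧ ∀ ω, F.ProperAt ω → ∀ (x w : ℕ → Vec nx) (y v : ℕ → Vec ny),
      (∀ t, x (t + 1) = F.A *ᵥ x t + w t) → (∀ t, 1 ≤ t → y t = F.C *ᵥ x t + v t) → ∀ n,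
      (x (F.T + n) - F.estimate ω y (F.T + n)) ⬝ᵥ (x (F.T + n) - F.estimate ω y (F.T + n)) ≤
        κ * ((F.state ω y n).energy (x n) +
          ∑ i : Fin F.T, B.noiseEnergy (w (n + i)) (v (n + i + 1))) := by
  obtain ⟨κ, hκ, hwin⟩ := F.exists_winError_le B.p_pos (inv_pos.2 B.b_pos)
  refine ⟨κ, hκ, fun ω hω x w y v hx hy n => ?_⟩
  have hst := B.regularState_state y hF hω n
  set st := F.state ω y n
  obtain ⟨hΦ, hΨ⟩ := B.variational_mem_Icc y hF hω hst (Nat.le_add_right F.T n) (F.N - 1)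
    (by omega)
  set u : WinVec F.T nx := fun q => x (n + q.1) q.2
  have hw (i : Fin F.T) : u.processNoise F.A i = w (n + i) :=
    sub_eq_of_eq_add' (hx (n + i))
  have hv (i : Fin F.T) :
      y (F.T + n - F.T + (i + 1)) - F.C *ᵥ u.block i.succ = v (n + i + 1) := by
    rw [Nat.add_sub_cancel_left]
    exact sub_eq_of_eq_add' (hy (n + i + 1) (by omega))
  have hlast : x (F.T + n) - F.estimate ω y (F.T + n) =
      WinVec.block (u - F.finalMean ω y (F.T + n) st) (Fin.last F.T) := by
    rw [estimate, Nat.add_sub_cancel_left, add_comm F.T n]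
    rfl
  have hcost := F.winCost_le y (F.T + n) (st := st) hΦ.2 hΨ.2 u
  simp only [hw, hv] at hcost
  rw [hlast]
  refine (hwin y (F.T + n) st _ _ u hst.P hst.P_le hΦ.1 (B.posDef_Ψ hΨ)).trans
    (mul_le_mul_of_nonneg_left (hcost.trans ?_) hκ)
  unfold noiseEnergy
  gcongr with i
  · exact le_rfl
  · exact dotProduct_self_nonneg_real (w (n + i))
  · exact half_pos B.a_pos
  · exact half_le_self B.a_pos.le

end StabilityBounds

end ErrorEnergy

end VBFilter

section MeanSquare

variable {Ω : Type*} [MeasurableSpace Ω] {μ : Measure Ω} {d nx ny : ℕ}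

lemma norm_toLp_sq (z : Vec d) : ‖WithLp.toLp 2 z‖ ^ 2 = z ⬝ᵥ z := by
  rw [EuclideanSpace.real_norm_sq_eq]
  exact Finset.sum_congr rfl fun i _ => sq (z i)

/-- The random vectors `u i` have second moments, which are bounded uniformly in `i`. -/
def BoundedInMeanSquare {ι : Type*} (μ : Measure Ω) (u : ι → Ω → Vec d) : Prop :=
  ∃ c : ℝ, ∀ i, MemLp (fun ω => WithLp.toLp 2 (u i ω)) 2 μ ∧
    ∫ ω, ‖WithLp.toLp 2 (u i ω)‖ ^ 2 ∂μ ≤ c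

/-- A linear system whose initial state and noises have bounded second moments; neither their
laws nor their correlations are restricted. -/
structure SquareIntegrableSystem (μ : Measure Ω) (A : Mat nx) (C : Matrix (Fin ny) (Fin nx) ℝ)
    (x : ℕ → Ω → Vec nx) (y : ℕ → Ω → Vec ny) (w : ℕ → Ω → Vec nx) (v : ℕ → Ω → Vec ny) :
    Prop where
  state_eq : ∀ t ω, x (t + 1) ω = A *ᵥ x t ω + w t ω
  meas_eq : ∀ t ω, 1 ≤ t → y t ω = C *ᵥ x t ω + v t ω
  memLp_x₀ : MemLp (fun ω => WithLp.toLp 2 (x 0 ω)) 2 μ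
  w : BoundedInMeanSquare μ w
  v : BoundedInMeanSquare μ fun t => v (t + 1)

lemma IsGaussianVec.memLp_two {u : Ω → Vec d} {m : Vec d} {S : Mat d}
    (h : IsGaussianVec μ u m S) : MemLp (fun ω => WithLp.toLp 2 (u ω)) 2 μ := by
  have hlaw : MemLp id 2 (μ.map fun ω => WithLp.toLp 2 (u ω)) := by
    rw [HasLaw.map_eq h]
    exact IsGaussian.memLp_two_id
  exact (memLp_map_measure_iff aestronglyMeasurable_id (HasLaw.aemeasurable h)).1 hlaw

lemma boundedInMeanSquare_of_isGaussianVec {ι : Type*} {u : ι → Ω → Vec d} {m : Vec d} {S : Mat d}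
    (h : ∀ i, IsGaussianVec μ (u i) m S) : BoundedInMeanSquare μ u :=
  ⟨∫ z, ‖z‖ ^ 2 ∂multivariateGaussian (WithLp.toLp 2 m) S, fun i => ⟨(h i).memLp_two,
    ((h i).integral_comp (f := fun z => ‖z‖ ^ 2) (by fun_prop)).le⟩⟩

lemma LinearGaussianSystem.squareIntegrableSystem {A : Mat nx} {C : Matrix (Fin ny) (Fin nx) ℝ}
    {Q P₀ : Mat nx} {R : Mat ny} {x₀ : Vec nx} {x w : ℕ → Ω → Vec nx} {y v : ℕ → Ω → Vec ny}
    (h : LinearGaussianSystem μ A C Q R x₀ P₀ x y w v) :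
    SquareIntegrableSystem μ A C x y w v where
  state_eq := h.state_eq
  meas_eq := h.meas_eq
  memLp_x₀ := h.law_x₀.memLp_two
  w := boundedInMeanSquare_of_isGaussianVec h.law_w
  v := boundedInMeanSquare_of_isGaussianVec fun t => h.law_v (t + 1) (Nat.le_add_left 1 t)

lemma aemeasurable_of_memLp_toLp {u : Ω → Vec d} (h : MemLp (fun ω => WithLp.toLp 2 (u ω)) 2 μ) :
    AEMeasurable u μ :=
  (WithLp.measurable_ofLp 2 _).comp_aemeasurable h.aestronglyMeasurable.aemeasurable

lemma integrable_dotProduct_self {u : Ω → Vec d}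
    (h : MemLp (fun ω => WithLp.toLp 2 (u ω)) 2 μ) : Integrable (fun ω => u ω ⬝ᵥ u ω) μ := by
  simpa only [norm_toLp_sq] using h.integrable_norm_pow two_ne_zero

lemma integrable_and_integral_le_of_ae_le {f g : Ω → ℝ} {c : ℝ} (hf : AEMeasurable f μ)
    (hf0 : 0 ≤ᵐ[μ] f) (hfg : f ≤ᵐ[μ] g) (hg : Integrable g μ ∧ ∫ ω, g ω ∂μ ≤ c) :
    Integrable f μ ∧ ∫ ω, f ω ∂μ ≤ c := by
  have hint : Integrable f μ := hg.1.mono' hf.aestronglyMeasurable <| by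
    filter_upwards [hf0, hfg] with ω h0 hle
    exact (Real.norm_of_nonneg h0).trans_le hle
  exact ⟨hint, (integral_mono_ae hint hg.1 hfg).trans hg.2⟩

lemma integrable_and_integral_le_of_le_mul_add_sum {ι : Type*} [Fintype ι] {f g : Ω → ℝ}
    {h : ι → Ω → ℝ} {κ K c : ℝ} (hκ : 0 ≤ κ) (hf : AEMeasurable f μ) (hf0 : 0 ≤ᵐ[μ] f)
    (hle : f ≤ᵐ[μ] fun ω => κ * (g ω + ∑ i, h i ω)) (hg : Integrable g μ ∧ ∫ ω, g ω ∂μ ≤ K)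
    (hh : ∀ i, Integrable (h i) μ ∧ ∫ ω, h i ω ∂μ ≤ c) :
    Integrable f μ ∧ ∫ ω, f ω ∂μ ≤ κ * (K + Fintype.card ι * c) := by
  have hsum := integrable_finsetSum Finset.univ fun i _ => (hh i).1
  refine integrable_and_integral_le_of_ae_le hf hf0 hle ⟨(hg.1.add hsum).const_mul κ, ?_⟩
  rw [integral_const_mul, integral_add hg.1 hsum, integral_finsetSum _ fun i _ => (hh i).1]
  gcongr
  · exact hg.2
  · exact (Finset.sum_le_card_nsmul _ _ c fun i _ => (hh i).2).trans_eq (nsmul_eq_mul _ _)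

lemma exists_integral_le_of_contraction {V W : ℕ → Ω → ℝ} {g c : ℝ} (hg : 0 ≤ g) (hg1 : g < 1)
    (hV : ∀ n, AEMeasurable (V n) μ) (hV0 : ∀ n, 0 ≤ᵐ[μ] V n) (hV₀ : Integrable (V 0) μ)
    (hstep : ∀ n, V (n + 1) ≤ᵐ[μ] fun ω => g * V n ω + W n ω)
    (hW : ∀ n, Integrable (W n) μ ∧ ∫ ω, W n ω ∂μ ≤ c) :
    ∃ K, ∀ n, Integrable (V n) μ ∧ ∫ ω, V n ω ∂μ ≤ K := by
  refine ⟨max (∫ ω, V 0 ω ∂μ) (c / (1 - g)), fun n => ?_⟩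
  set K := max (∫ ω, V 0 ω ∂μ) (c / (1 - g))
  have hK : c ≤ (1 - g) * K :=
    (div_le_iff₀' (sub_pos.2 hg1)).1 (le_max_right (∫ ω, V 0 ω ∂μ) (c / (1 - g)))
  induction n with
  | zero => exact ⟨hV₀, le_max_left _ _⟩
  | succ n ih =>
    have hgV := ih.1.const_mul g
    refine integrable_and_integral_le_of_ae_le (hV _) (hV0 _) (hstep n) ⟨hgV.add (hW n).1, ?_⟩
    calc ∫ ω, g * V n ω + W n ω ∂μ = g * ∫ ω, V n ω ∂μ + ∫ ω, W n ω ∂μ := by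
          rw [integral_add hgV (hW n).1, integral_const_mul]
      _ ≤ g * K + c := add_le_add (mul_le_mul_of_nonneg_left ih.2 hg) (hW n).2
      _ ≤ K := by linarith

namespace SquareIntegrableSystem

variable {A : Mat nx} {C : Matrix (Fin ny) (Fin nx) ℝ} {x w : ℕ → Ω → Vec nx}
  {y v : ℕ → Ω → Vec ny}

lemma aemeasurable_state (h : SquareIntegrableSystem μ A C x y w v) (t : ℕ) :
    AEMeasurable (x t) μ := by
  induction t with
  | zero => exact aemeasurable_of_memLp_toLp h.memLp_x₀
  | succ t ih =>
    obtain ⟨c, hw⟩ := h.w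
    have := aemeasurable_of_memLp_toLp (hw t).1
    rw [funext (h.state_eq t)]
    fun_prop

lemma aemeasurable_meas (h : SquareIntegrableSystem μ A C x y w v) (t : ℕ) (ht : 1 ≤ t) :
    AEMeasurable (y t) μ := by
  obtain ⟨c, hv⟩ := h.v
  obtain ⟨n, rfl⟩ := Nat.exists_eq_add_of_le' ht
  have hvn : AEMeasurable (v (n + 1)) μ := aemeasurable_of_memLp_toLp (hv n).1
  have := h.aemeasurable_state (n + 1)
  rw [show y (n + 1) = _ from funext fun ω => h.meas_eq (n + 1) ω ht]
  fun_prop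

end SquareIntegrableSystem

namespace VBFilter

namespace StabilityBounds

variable {F : VBFilter Ω nx ny} (B : F.StabilityBounds) {x w : ℕ → Ω → Vec nx}
  {y v : ℕ → Ω → Vec ny}

lemma exists_integral_noiseEnergy_le (hw : BoundedInMeanSquare μ w)
    (hv : BoundedInMeanSquare μ fun t => v (t + 1)) :
    ∃ c, ∀ t, Integrable (fun ω => B.noiseEnergy (w t ω) (v (t + 1) ω)) μ ∧
      ∫ ω, B.noiseEnergy (w t ω) (v (t + 1) ω) ∂μ ≤ c := by
  obtain ⟨cw, hw⟩ := hw
  obtain ⟨cv, hv⟩ := hv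
  simp only [norm_toLp_sq] at hw hv
  refine ⟨(B.a / 2)⁻¹ * cw + B.β⁻¹ * cv, fun t => ?_⟩
  have hwt := (integrable_dotProduct_self (hw t).1).const_mul (B.a / 2)⁻¹
  have hvt := (integrable_dotProduct_self (hv t).1).const_mul B.β⁻¹
  have ha := B.a_pos
  have hβ := B.β_pos
  refine ⟨hwt.add hvt, ?_⟩
  simp only [noiseEnergy]
  rw [integral_add hwt hvt, integral_const_mul, integral_const_mul]
  gcongr
  exacts [(hw t).2, (hv t).2]

end StabilityBounds

lemma integrable_energy_state_zero [IsFiniteMeasure μ] (F : VBFilter Ω nx ny)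
    (hP₀ : F.P₀.PosDef) {x : Ω → Vec nx} (y : ℕ → Ω → Vec ny)
    (hx : MemLp (fun ω => WithLp.toLp 2 (x ω)) 2 μ) :
    Integrable (fun ω => (F.state ω (fun k => y k ω) 0).energy (x ω)) μ := by
  have hmem : MemLp (fun ω => WithLp.toLp 2 (x ω - F.x₀)) 2 μ :=
    hx.sub (memLp_const (WithLp.toLp 2 F.x₀))
  have hmeas := aemeasurable_of_memLp_toLp hmem
  refine ((integrable_dotProduct_self hmem).const_mul F.P₀⁻¹.trace).mono'
    (AEMeasurable.aestronglyMeasurable ?_) (ae_of_all μ fun ω => ?_)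
  · exact aemeasurable_dotProduct hmeas
      (aemeasurable_mulVec (f := fun _ => F.P₀⁻¹) aemeasurable_const hmeas)
  · have hle := dotProduct_mulVec_mono
      (le_trace_smul_one (nonneg_iff_posSemidef.2 hP₀.inv.posSemidef)) (x ω - F.x₀)
    rw [smul_mulVec, one_mulVec, dotProduct_smul] at hle
    exact (Real.norm_of_nonneg (dotProduct_mulVec_nonneg hP₀.inv.posSemidef _)).trans_le hle

lemma StabilityBounds.exists_integral_energy_le [IsFiniteMeasure μ] {F : VBFilter Ω nx ny}
    (B : F.StabilityBounds) (hF : F.Admissible μ) {x w : ℕ → Ω → Vec nx} {y v : ℕ → Ω → Vec ny}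
    (hsys : SquareIntegrableSystem μ F.A F.C x y w v) :
    ∃ K, ∀ n, Integrable (fun ω => (F.state ω (fun k => y k ω) n).energy (x n ω)) μ ∧
      ∫ ω, (F.state ω (fun k => y k ω) n).energy (x n ω) ∂μ ≤ K := by
  obtain ⟨c, hc⟩ := B.exists_integral_noiseEnergy_le hsys.w hsys.v
  refine exists_integral_le_of_contraction B.rate_nonneg B.rate_lt_one (fun n => ?_) (fun n => ?_)
    (F.integrable_energy_state_zero hF.posDef_P₀ y hsys.memLp_x₀) (fun n => ?_) hc
  · have hst := hF.aemeas_state hsys.aemeasurable_meas n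
    have hx := (hsys.aemeasurable_state n).sub hst.x
    exact aemeasurable_dotProduct hx (aemeasurable_mulVec (aemeasurable_matrix_inv hst.P) hx)
  · filter_upwards [hF.ae_properAt] with ω hω
    exact State.energy_nonneg (B.regularState_state _ hF hω n).P.posSemidef _
  · filter_upwards [hF.ae_properAt] with ω hω
    refine B.energy_update_le hF hω (B.regularState_state _ hF hω n) (Nat.le_add_right _ _)
      (hsys.state_eq n ω) ?_
    rw [Nat.add_sub_cancel_left]
    exact hsys.meas_eq (n + 1) ω (Nat.le_add_left 1 n)

end VBFilter

end MeanSquare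

end VBMHE

end

theorem theorem1_general {Ω : Type*} [MeasurableSpace Ω] (μ : Measure Ω) [IsFiniteMeasure μ]
    {nx ny : ℕ} (F : VBMHE.VBFilter Ω nx ny) (hF : F.Admissible μ)
    (x : ℕ → Ω → VBMHE.Vec nx) (y : ℕ → Ω → VBMHE.Vec ny)
    (w : ℕ → Ω → VBMHE.Vec nx) (v : ℕ → Ω → VBMHE.Vec ny)
    (hsys : VBMHE.SquareIntegrableSystem μ F.A F.C x y w v)
    (A1 : VBMHE.Detectable F.A F.C)
    (A2 : ∃ a b : ℝ, 0 < a ∧ a ≤ b ∧ VBMHE.LoewnerBounded F.𝒬 a b)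
    (A3 : ∃ a b : ℝ, 0 < a ∧ a ≤ b ∧ VBMHE.LoewnerBounded F.ℛ a b) :
    ∃ c : ℝ, ∀ t : ℕ, F.T ≤ t →
      Integrable (fun ω =>
        ‖WithLp.toLp 2 (x t ω - F.estimate ω (fun k => y k ω) t)‖ ^ 2) μ ∧
      ∫ ω, ‖WithLp.toLp 2 (x t ω - F.estimate ω (fun k => y k ω) t)‖ ^ 2 ∂μ ≤ c := by
  obtain ⟨B⟩ := VBMHE.VBFilter.nonempty_stabilityBounds hF.posDef_P₀.posSemidef A1 A2 A3
  obtain ⟨κ, hκ, herror⟩ := B.exists_sq_estimate_error_le hF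
  obtain ⟨K, henergy⟩ := B.exists_integral_energy_le hF hsys
  obtain ⟨c, hnoise⟩ := B.exists_integral_noiseEnergy_le hsys.w hsys.v
  refine ⟨κ * (K + Fintype.card (Fin F.T) * c), fun t ht => ?_⟩
  obtain ⟨n, rfl⟩ := Nat.exists_eq_add_of_le ht
  simp only [VBMHE.norm_toLp_sq]
  have herr := (hsys.aemeasurable_state (F.T + n)).sub
    (hF.aemeasurable_estimate hsys.aemeasurable_meas ht)
  have hle := hF.ae_properAt.mono fun ω hω => herror ω hω (x · ω) (w · ω) (y · ω) (v · ω)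
    (hsys.state_eq · ω) (hsys.meas_eq · ω) n
  exact VBMHE.integrable_and_integral_le_of_le_mul_add_sum hκ
    (VBMHE.aemeasurable_dotProduct herr herr)
    (ae_of_all μ fun ω => VBMHE.dotProduct_self_nonneg_real _) hle (henergy n)
    fun i : Fin F.T => hnoise (n + i)

theorem theorem1 {Ω : Type*} [MeasurableSpace Ω] (μ : Measure Ω) [IsProbabilityMeasure μ]
    {nx ny : ℕ} (F : VBMHE.VBFilter Ω nx ny) (hF : F.Admissible μ)
    (Q : VBMHE.Mat nx) (R : VBMHE.Mat ny) (hQ : Q ∈ F.𝒬) (hR : R ∈ F.ℛ)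
    (x : ℕ → Ω → VBMHE.Vec nx) (y : ℕ → Ω → VBMHE.Vec ny)
    (w : ℕ → Ω → VBMHE.Vec nx) (v : ℕ → Ω → VBMHE.Vec ny)
    (hsys : VBMHE.LinearGaussianSystem μ F.A F.C Q R F.x₀ F.P₀ x y w v)
    (A1 : VBMHE.Detectable F.A F.C)
    (A2 : ∃ a b : ℝ, 0 < a ∧ a ≤ b ∧ VBMHE.LoewnerBounded F.𝒬 a b)
    (A3 : ∃ a b : ℝ, 0 < a ∧ a ≤ b ∧ VBMHE.LoewnerBounded F.ℛ a b) :
    ∃ c : ℝ, ∀ t : ℕ, F.T ≤ t →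
      Integrable (fun ω =>
        ‖WithLp.toLp 2 (x t ω - F.estimate ω (fun k => y k ω) t)‖ ^ 2) μ ∧
      ∫ ω, ‖WithLp.toLp 2 (x t ω - F.estimate ω (fun k => y k ω) t)‖ ^ 2 ∂μ ≤ c :=
  theorem1_general μ F hF x y w v hsys.squareIntegrableSystem A1 A2 A3
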